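/- For bounded complex sequences $a,b,c$ on $\mathbb Z$ let $J$ be the Jacobi operator on $\ell^2(\mathbb Z)$ given by $(Ju)_n=a_{n-1}u_{n-1}+b_nu_n+c_nu_{n+1}$, and put $$v_n=\max\{|a_{n-1}-1|,|a_n-1|,|b_n|,|c_{n-1}-1|,|c_n-1|\}.$$ Let $\sigma_{\mathrm d}(J)$ be the discrete spectrum of $J$ (the isolated eigenvalues of finite algebraic multiplicity). For $p\ge 1$ and $f:[0,\infty)\to(0,\infty)$ with $v\in\ell^p(\mathbb Z)$, $v\neq0$, set $$R_p(J,f)=\frac1{\|v\|_{\ell^p}^p}\sum_{\lambda\in\sigma_{\mathrm d}(J)}\frac{\operatorname{dist}(\lambda,[-2,2])^p}{|\lambda^2-4|^{1/2}}\,f\!\left(-\log\frac{\operatorname{dist}(\lambda,[-2,2])}{\operatorname{dist}(\lambda,\{-2,2\})}\right)\in[0,\infty].$$ The sum may be read in either of two ways, with each eigenvalue counted once or counted according to its algebraic multiplicity; every assertion below holds for both readings. For $n\in\mathbb N$ let $J_n$ be the discrete Schrödinger operator with $a_k=c_k=1$ for all $k\in\mathbb Z$, $b_k=\mathrm i\,n^{-2/3}$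 for $k\in\{1,\dots,n\}$ and $b_k=0$ otherwise. Put $F(t)=\int_0^t f(x)\,dx$ for $t\ge0$. **Theorem.** Let $p\ge1$. (1) There is a constant $C_p>0$, depending only on $p$, such that the following holds. Let $\gamma\in(2/3,1)$ and let $g:[1,\infty)\to[1,\infty)$ satisfy $g(n)\to\infty$ and $g(n)/n^{\gamma-2/3}\to0$ as $n\to\infty$ along the positive integers. Then there is an integer $n_*\ge2$ (depending on $p$, $\gamma$ and $g$, but not on $f$) such that for all continuous, non-increasing $f:[0,\infty)\to(0,\infty)$ with $\int_0^\infty f(x)\,dx=\infty$ and all integers $n\ge n_*$, $$R_p(J_n,f)\ \ge\ C_p\bigl(F(\log n^{2/3})-3f(0)\log g(n)\bigr),$$ and consequently the supremum of $R_p(J,f)$ over all Jacobi operators $J$ with $0\ne v\in\ell^p(\mathbb Z)$ is bounded below by the same quantity. (2) For every continuous, non-increasing $f:[0,\infty)\to(0,\infty)$ with $\int_0^\infty f(x)\,dx=\infty$, the supremum of $R_p(J,f)$ over all Jacobi operators $J$ with $0\neq v\in\ell^p(\mathbb Z)$ is $+\infty$; that is, there is no constant $C$ with $$\sum_{\lambda\in\sigma_{\mathrm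 d}(J)}\frac{\operatorname{dist}(\lambda,[-2,2])^p}{|\lambda^2-4|^{1/2}}\,f\!\left(-\log\frac{\operatorname{dist}(\lambda,[-2,2])}{\operatorname{dist}(\lambda,\{-2,2\})}\right)\le C\,\|v\|_{\ell^p}^p$$ for all such $J$. -/

import Mathlib

open scoped ENNReal

noncomputable section

namespace Jacobi

/-! ### Jacobi operators on `ℓ²(ℤ)` -/

/-- The Hilbert space `ℓ²(ℤ)` of square-summable complex sequences. -/
abbrev L2Z : Type := lp (fun _ : ℤ => ℂ) 2

/-- The space `ℓ^∞(ℤ)` of bounded complex sequences. -/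
abbrev BddSeq : Type := lp (fun _ : ℤ => ℂ) ∞

theorem memLp_mul (a : BddSeq) (u : L2Z) : Memℓp (fun n : ℤ => a n * u n) 2 := by
  have h : Memℓp (fun n : ℤ => (‖a‖ : ℂ) * u n) 2 := (lp.memℓp u).const_mul _
  rw [memℓp_gen_iff (by norm_num)] at h ⊢
  refine h.of_nonneg_of_le (fun n => by positivity) (fun n => ?_)
  gcongr
  simp only [norm_mul, Complex.norm_real, norm_norm]
  gcongr
  exact lp.norm_apply_le_norm (by simp) a n

theorem memLp_shift (k : ℤ) (u : L2Z) : Memℓp (fun n : ℤ => u (n + k)) 2 := by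
  have h := lp.memℓp u
  rw [memℓp_gen_iff (by norm_num)] at h ⊢
  exact (Equiv.addRight k).summable_iff.mpr h

/-- Multiplication by a bounded sequence, `(D u)_n = a_n u_n`. -/
def diagOp (a : BddSeq) : L2Z →L[ℂ] L2Z :=
  LinearMap.mkContinuous
    { toFun := fun u => ⟨fun n => a n * u n, memLp_mul a u⟩
      map_add' := fun u w => by
        ext n
        exact mul_add _ _ _
      map_smul' := fun z u => by
        ext n
        simp [mul_left_comm] }
    ‖a‖ (fun u => by
      have h : ‖(‖a‖ : ℂ) • u‖ = ‖a‖ * ‖u‖ := by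
        rw [norm_smul, Complex.norm_real, norm_norm]
      rw [← h]
      refine lp.norm_mono (p := 2) (by norm_num) (fun n => ?_)
      simp only [LinearMap.coe_mk, AddHom.coe_mk, lp.coeFn_smul, Pi.smul_apply, smul_eq_mul,
        norm_mul, Complex.norm_real, norm_norm]
      gcongr
      exact lp.norm_apply_le_norm (by simp) a n)

/-- The shift `(S u)_n = u_{n+k}`. -/
def shiftOp (k : ℤ) : L2Z →L[ℂ] L2Z :=
  LinearMap.mkContinuous
    { toFun := fun u => ⟨fun n => u (n + k), memLp_shift k u⟩
      map_add' := fun u w => rfl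
      map_smul' := fun z u => by
        ext n
        simp }
    1 (fun u => by
      rw [one_mul, lp.norm_eq_tsum_rpow (by norm_num), lp.norm_eq_tsum_rpow (by norm_num)]
      apply le_of_eq
      congr 1
      exact (Equiv.addRight k).tsum_eq (fun n => ‖u n‖ ^ (2 : ℝ≥0∞).toReal))

/-- The Jacobi operator with coefficient sequences `a`, `b`, `c`; see `jacobiOp_apply`. -/
def jacobiOp (a b c : BddSeq) : L2Z →L[ℂ] L2Z :=
  shiftOp (-1) ∘L diagOp a + diagOp b + diagOp c ∘L shiftOp 1

theorem jacobiOp_apply (a b c : BddSeq) (u : L2Z) (n : ℤ) :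
    jacobiOp a b c u n = a (n - 1) * u (n - 1) + b n * u n + c n * u (n + 1) := rfl

/-- The deviation from the free Jacobi operator,
`v_n = max {|a_{n-1} - 1|, |a_n - 1|, |b_n|, |c_{n-1} - 1|, |c_n - 1|}`. -/
def deviation (a b c : BddSeq) (n : ℤ) : ℝ :=
  max ‖a (n - 1) - 1‖ (max ‖a n - 1‖ (max ‖b n‖ (max ‖c (n - 1) - 1‖ ‖c n - 1‖)))

/-! ### Discrete spectrum -/

/-- `lam` is an isolated point of the spectrum of `T`, and `r` is the radius of a closed disc
around `lam` that contains no other point of the spectrum. -/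
def IsIsolatingRadius (T : L2Z →L[ℂ] L2Z) (lam : ℂ) (r : ℝ) : Prop :=
  0 < r ∧ Metric.closedBall lam r ∩ spectrum ℂ T = {lam}

open Classical in
/-- The Riesz projection `(2πi)⁻¹ ∮ (z - T)⁻¹ dz` of an isolated point `lam` of the spectrum,
where the integral is over a circle around `lam` that separates `lam` from the rest of the spectrum
(by Cauchy's theorem the radius is immaterial). -/
def rieszProjection (T : L2Z →L[ℂ] L2Z) (lam : ℂ) : L2Z →L[ℂ] L2Z :=
  if h : ∃ r, IsIsolatingRadius T lam r then
    (2 * (Real.pi : ℂ) * Complex.I)⁻¹ • ∮ z in C(lam, h.choose), resolvent T z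
  else 0

/-- The discrete spectrum: the isolated eigenvalues of finite algebraic multiplicity, that is,
with a Riesz projection of finite rank. -/
def discreteSpectrum (T : L2Z →L[ℂ] L2Z) : Set ℂ :=
  {lam | (∃ r, IsIsolatingRadius T lam r) ∧
    Module.End.HasEigenvalue (T : L2Z →ₗ[ℂ] L2Z) lam ∧
    FiniteDimensional ℂ (LinearMap.range (rieszProjection T lam : L2Z →ₗ[ℂ] L2Z))}

/-- The algebraic multiplicity of a discrete eigenvalue: the rank of its Riesz projection. -/
def algMultiplicity (T : L2Z →L[ℂ] L2Z) (lam : ℂ) : ℕ :=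
  Module.finrank ℂ (LinearMap.range (rieszProjection T lam : L2Z →ₗ[ℂ] L2Z))

/-- The two ways to count eigenvalues in a sum over the discrete spectrum: each one once, or each
one according to its algebraic multiplicity. -/
def countings : Set ((L2Z →L[ℂ] L2Z) → ℂ → ℕ) :=
  {fun _ _ => 1, algMultiplicity}

/-! ### Weighted eigenvalue sums -/

/-- The interval `[-2, 2]` as a subset of `ℂ`. -/
def freeSpectrum : Set ℂ := (fun x : ℝ => (x : ℂ)) '' Set.Icc (-2) 2

/-- `dist(λ, [-2,2])^p / |λ² - 4|^{1/2} * f(-log(dist(λ, [-2,2]) / dist(λ, {-2,2})))`. -/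
def eigenvalueWeight (p : ℝ) (f : ℝ → ℝ) (lam : ℂ) : ℝ :=
  Metric.infDist lam freeSpectrum ^ p / ‖lam ^ 2 - 4‖ ^ (1 / 2 : ℝ) *
    f (-Real.log (Metric.infDist lam freeSpectrum / Metric.infDist lam {-2, 2}))

/-- The sum of the weights over the discrete spectrum, counted with `m`, in `[0, ∞]`. -/
def eigenvalueSum (m : (L2Z →L[ℂ] L2Z) → ℂ → ℕ) (p : ℝ) (f : ℝ → ℝ) (T : L2Z →L[ℂ] L2Z) : ℝ≥0∞ :=
  ∑' lam : discreteSpectrum T, (m T lam : ℝ≥0∞) * ENNReal.ofReal (eigenvalueWeight p f lam)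

/-- `‖v‖_p^p`, in `[0, ∞]`. -/
def normPow (p : ℝ) (v : ℤ → ℝ) : ℝ≥0∞ := ∑' n : ℤ, ENNReal.ofReal (|v n| ^ p)

/-- The eigenvalue sum of the Jacobi operator divided by `‖v‖_p^p`. -/
def ratio (m : (L2Z →L[ℂ] L2Z) → ℂ → ℕ) (p : ℝ) (f : ℝ → ℝ) (a b c : BddSeq) : ℝ≥0∞ :=
  eigenvalueSum m p f (jacobiOp a b c) / normPow p (deviation a b c)

/-- The supremum of the ratio over all Jacobi operators with `0 ≠ v ∈ ℓ^p(ℤ)`. -/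
def supRatio (m : (L2Z →L[ℂ] L2Z) → ℂ → ℕ) (p : ℝ) (f : ℝ → ℝ) : ℝ≥0∞ :=
  ⨆ (a : BddSeq) (b : BddSeq) (c : BddSeq) (_ : deviation a b c ≠ 0)
    (_ : Memℓp (deviation a b c) (ENNReal.ofReal p)), ratio m p f a b c

/-- A continuous non-increasing function `f : [0, ∞) → (0, ∞)` with `∫₀^∞ f = ∞`. (The values of
`f` at negative numbers play no role.) -/
structure IsNonintegrableWeight (f : ℝ → ℝ) : Prop where
  continuousOn : ContinuousOn f (Set.Ici 0)
  antitoneOn : AntitoneOn f (Set.Ici 0)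
  pos : ∀ x, 0 ≤ x → 0 < f x
  lintegral_eq_top : ∫⁻ x in Set.Ioi (0 : ℝ), ENNReal.ofReal (f x) = ∞

/-! ### The discrete Schrödinger operator -/

/-- The potential `b_k = i n^{-2/3}` for `1 ≤ k ≤ n`, and `b_k = 0` otherwise. -/
def potentialFun (n : ℕ) (k : ℤ) : ℂ :=
  if 1 ≤ k ∧ k ≤ n then Complex.I * (((n : ℝ) ^ (-2 / 3 : ℝ) : ℝ) : ℂ) else 0

theorem memLp_potentialFun (n : ℕ) : Memℓp (potentialFun n) ∞ := by
  refine memℓp_infty ⟨(n : ℝ) ^ (-2 / 3 : ℝ), ?_⟩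
  rintro _ ⟨k, rfl⟩
  have h0 : (0 : ℝ) ≤ (n : ℝ) ^ (-2 / 3 : ℝ) := by positivity
  dsimp only [potentialFun]
  split_ifs
  · rw [norm_mul, Complex.norm_I, one_mul, Complex.norm_real, Real.norm_of_nonneg h0]
  · simpa using h0

/-- The potential as a bounded sequence. -/
def potential (n : ℕ) : BddSeq := ⟨potentialFun n, memLp_potentialFun n⟩

end Jacobi

end

/-!
The discrete Schrödinger operator with potential `v = i h` on `{1, …, n}` is a finite-rank
perturbation of the free operator, whose spectrum is contained in `[-2, 2]`. A point
`lam = k + k⁻¹`, `‖k‖ < 1`, outside `[-2, 2]` is in the spectrum only if it is an eigenvalue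
(`hasEigenvalue_of_mem_spectrum`, by the Fredholm alternative), and then `k` is a root of a fixed
nonzero polynomial (`finite_spectrum_diff_freeSpectrum`). Hence every such eigenvalue is isolated.
Its Riesz projection is idempotent (`rieszProjection_mul_self`), compact, and fixes the eigenvectors,
so it has finite nonzero rank (`finiteDimensional_range_rieszProjection`). All that remains is to
produce enough eigenvalues; both ways of counting give each of them weight at least one.

Write `w = exp (i ζ)` and `e = ± w ^ n`. The symmetric and antisymmetric matching of
`w ^ j + e w ^ (1 - j)` to exponentials that decay outside `{1, …, n}` shows that
`2 cos ζ + i h` is an eigenvalue as soon as `4 e sin² ζ = i h (1 + 2 e cos ζ + e²)`, with suitable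
signs of imaginary parts (`mem_discreteSpectrum_of_secular`). To leading order
`e ≈ i h / (4 sin² ζ)`, so that `Re ζ ≈ θ_j = π (2 j + 1) / (2 n)` and
`Im ζ ≈ log (4 sin² θ_j / h) / n`. For `θ_j` between `20 √h` and `1 / 2` a true solution near this
point is supplied by the quantitative open mapping theorem (`exists_secular_zero`). When
`h = n ^ (-2 / 3)` the imaginary part of `ζ` is negligible against `h`, and the eigenvalue `lam_j`
satisfies `dist (lam_j, [-2, 2]) ≥ h / 2` and `|lam_j - 2| ≤ 9 θ_j²`.

Since `f` is non-increasing, the contribution of `lam_j` to the sum is at least a constant times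
`h ^ p f (log (18 θ_j² / h)) / θ_j`. In the variable `x = log (18 θ² / h)`, for which
`dx = 2 dθ / θ`, the sum over `j` dominates `n h ^ p` times the integral of `f` between a constant
and `log (1 / h) = log n ^ (2 / 3)` (`integral_le_sum_gridAngle`), while `‖v‖_p ^ p = n h ^ p`.
The missing piece of the integral is at most `f 0` times a constant, hence at most
`3 f 0 log (g n)` for large `n`; and the integral tends to infinity because `f` is not integrable.
-/

/-! ### The Riesz projection of a finite-rank perturbation -/

namespace Jacobi

open MeasureTheory Metric Set

section CircleIntegral

variable {E : Type*} [NormedAddCommGroup E] [NormedSpace ℂ E]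

/-- Fubini's theorem for two circle integrals. -/
theorem circleIntegral_swap {f : ℂ → ℂ → E} {c : ℂ} {R r : ℝ} (hR : 0 ≤ R) (hr : 0 ≤ r)
    (hf : ContinuousOn (Function.uncurry f) (sphere c R ×ˢ sphere c r)) :
    (∮ z in C(c, R), ∮ w in C(c, r), f z w) = ∮ w in C(c, r), ∮ z in C(c, R), f z w := by
  unfold circleIntegral
  simp only [← intervalIntegral.integral_smul]
  rw [intervalIntegral_intervalIntegral_swap]
  · simp only [smul_comm (deriv (circleMap c R) _)]
  · have hcont : Continuous (Function.uncurry fun x y : ℝ =>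
        deriv (circleMap c R) x • deriv (circleMap c r) y •
          f (circleMap c R x) (circleMap c r y)) := by
      simp only [deriv_circleMap]
      have h1 : Continuous fun q : ℝ × ℝ =>
          Function.uncurry f (circleMap c R q.1, circleMap c r q.2) :=
        hf.comp_continuous (by fun_prop) fun q =>
          ⟨circleMap_mem_sphere c hR _, circleMap_mem_sphere c hr _⟩
      have h2 : ∀ (c : ℂ) (r : ℝ), Continuous fun x : ℝ => circleMap 0 r x * Complex.I :=
        fun c r => by fun_prop
      exact ((h2 0 R).comp continuous_fst).smul (((h2 0 r).comp continuous_snd).smul h1)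
    exact (hcont.continuousOn.integrableOn_compact
      (isCompact_uIcc.prod isCompact_uIcc)).mono_set
      (prod_mono uIoc_subset_uIcc uIoc_subset_uIcc)

variable [CompleteSpace E] {F : Type*} [NormedAddCommGroup F] [NormedSpace ℂ F] [CompleteSpace F]

theorem circleIntegral_clm_comp_comm (L : E →L[ℂ] F) {f : ℂ → E} {c : ℂ} {R : ℝ}
    (hf : CircleIntegrable f c R) : (∮ z in C(c, R), L (f z)) = L (∮ z in C(c, R), f z) := by
  unfold circleIntegral
  rw [← L.intervalIntegral_comp_comm hf.out]
  simp

theorem circleIntegral_mem_of_isClosed (K : Submodule ℂ E) (hK : IsClosed (K : Set E))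
    {f : ℂ → E} {c : ℂ} {R : ℝ} (hR : 0 ≤ R) (hf : CircleIntegrable f c R)
    (h : ∀ z ∈ sphere c R, f z ∈ K) : (∮ z in C(c, R), f z) ∈ K := by
  unfold circleIntegral
  rw [intervalIntegral.integral_of_le Real.two_pi_pos.le,
    ← measure_smul_setAverage _ measure_Ioc_lt_top.ne]
  refine K.smul_of_tower_mem _ ?_
  have hconv : Convex ℝ (K : Set E) := (K.restrictScalars ℝ).convex
  refine hconv.set_average_mem hK (by simp [Real.pi_pos]) measure_Ioc_lt_top.ne ?_ ?_
  · refine .of_forall fun θ => ?_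
    exact K.smul_mem _ (h _ (circleMap_mem_sphere c hR θ))
  · exact (intervalIntegrable_iff_integrableOn_Ioc_of_le Real.two_pi_pos.le).1 hf.out

end CircleIntegral

section Resolvent

variable {A : Type*} [NormedRing A] [NormedAlgebra ℂ A]

/-- The first resolvent identity, solved for the product. -/
theorem resolvent_mul_resolvent {a : A} {z w : ℂ} (hz : z ∉ spectrum ℂ a)
    (hw : w ∉ spectrum ℂ a) (hne : w ≠ z) :
    resolvent a z * resolvent a w = (w - z)⁻¹ • (resolvent a z - resolvent a w) := by
  have hz' := spectrum.notMem_iff.1 hz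
  have hw' := spectrum.notMem_iff.1 hw
  have key : resolvent a z - resolvent a w = (w - z) • (resolvent a z * resolvent a w) := by
    have h : (w - z) • (1 : A) = (algebraMap ℂ A w - a) - (algebraMap ℂ A z - a) := by
      rw [Algebra.algebraMap_eq_smul_one, Algebra.algebraMap_eq_smul_one, sub_smul]; abel
    calc resolvent a z - resolvent a w
        = resolvent a z * ((algebraMap ℂ A w - a) - (algebraMap ℂ A z - a)) * resolvent a w := by
          rw [mul_sub, sub_mul, mul_assoc, resolvent, resolvent, Ring.mul_inverse_cancel _ hw',
            Ring.inverse_mul_cancel _ hz', mul_one, one_mul]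
      _ = _ := by rw [← h]; simp
  rw [key, smul_smul, inv_mul_cancel₀ (sub_ne_zero.2 hne), one_smul]

variable [CompleteSpace A]

theorem differentiableAt_resolvent {a : A} {z : ℂ} (hz : z ∉ spectrum ℂ a) :
    DifferentiableAt ℂ (resolvent a) z :=
  (spectrum.hasDerivAt_resolvent_const_left (spectrum.notMem_iff.1 hz)).differentiableAt

theorem continuousOn_resolvent {a : A} {s : Set ℂ} (hs : ∀ z ∈ s, z ∉ spectrum ℂ a) :
    ContinuousOn (resolvent a) s :=
  fun z hz => (differentiableAt_resolvent (hs z hz)).continuousAt.continuousWithinAt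

theorem circleIntegrable_resolvent {a : A} {c : ℂ} {r : ℝ} (hr : 0 ≤ r)
    (h : ∀ z ∈ sphere c r, z ∉ spectrum ℂ a) : CircleIntegrable (resolvent a) c r :=
  (continuousOn_resolvent h).circleIntegrable hr

theorem circleIntegral_resolvent_eq {a : A} {c : ℂ} {r R : ℝ} (hr : 0 < r) (hrR : r ≤ R)
    (h : ∀ z ∈ closedBall c R \ ball c r, z ∉ spectrum ℂ a) :
    (∮ z in C(c, R), resolvent a z) = ∮ z in C(c, r), resolvent a z := by
  refine Complex.circleIntegral_eq_of_differentiable_on_annulus_off_countable hr hrR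
    countable_empty (continuousOn_resolvent h) fun z hz => differentiableAt_resolvent (h z ?_)
  exact ⟨ball_subset_closedBall hz.1.1, fun h' => hz.1.2 (ball_subset_closedBall h')⟩

theorem circleIntegral_resolvent_eq_zero {a : A} {c : ℂ} {r : ℝ} (hr : 0 ≤ r)
    (h : ∀ z ∈ closedBall c r, z ∉ spectrum ℂ a) :
    (∮ z in C(c, r), resolvent a z) = 0 :=
  Complex.circleIntegral_eq_zero_of_differentiable_on_off_countable hr countable_empty
    (continuousOn_resolvent h)
    fun z hz => differentiableAt_resolvent (h z (ball_subset_closedBall hz.1))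

/-- The product of two contour integrals of the resolvent over concentric circles; with
`circleIntegral_resolvent_eq` it says that the Riesz projection is idempotent. -/
theorem circleIntegral_resolvent_mul {a : A} {c : ℂ} {r R : ℝ} (hr : 0 < r) (hrR : r < R)
    (hR' : ∀ z ∈ sphere c R, z ∉ spectrum ℂ a) (hr' : ∀ z ∈ sphere c r, z ∉ spectrum ℂ a) :
    (∮ z in C(c, R), resolvent a z) * (∮ w in C(c, r), resolvent a w) =
      (2 * (Real.pi : ℂ) * Complex.I) • ∮ w in C(c, r), resolvent a w := by
  have hR := hr.trans hrR
  have hne : ∀ z ∈ sphere c R, ∀ w ∈ sphere c r, w - z ≠ 0 := by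
    rintro z hz w hw h
    rw [sub_eq_zero.1 h, mem_sphere] at hw
    rw [mem_sphere] at hz
    exact hrR.ne (hw.symm.trans hz)
  have hIR := circleIntegrable_resolvent hR.le hR'
  have hIr := circleIntegrable_resolvent hr.le hr'
  -- the inner integral, for fixed `z` on the outer circle
  have inner : ∀ z ∈ sphere c R, resolvent a z * (∮ w in C(c, r), resolvent a w) =
      -∮ w in C(c, r), (w - z)⁻¹ • resolvent a w := by
    intro z hz
    have h1 : resolvent a z * (∮ w in C(c, r), resolvent a w) =
        ∮ w in C(c, r), resolvent a z * resolvent a w :=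
      (circleIntegral_clm_comp_comm (ContinuousLinearMap.mul ℂ A (resolvent a z)) hIr).symm
    have hcinv : ContinuousOn (fun w : ℂ => (w - z)⁻¹) (sphere c r) :=
      (continuousOn_id.sub continuousOn_const).inv₀ (hne z hz)
    have h2 : (∮ w in C(c, r), resolvent a z * resolvent a w) =
        ∮ w in C(c, r), ((w - z)⁻¹ • resolvent a z - (w - z)⁻¹ • resolvent a w) := by
      refine circleIntegral.integral_congr hr.le fun w hw => ?_
      rw [resolvent_mul_resolvent (hR' z hz) (hr' w hw) (sub_ne_zero.1 (hne z hz w hw)), smul_sub]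
    have h3 : (∮ w in C(c, r), (w - z)⁻¹) = 0 := by
      have hz' : ∀ w ∈ closedBall c r, w - z ≠ 0 := by
        intro w hw h
        rw [sub_eq_zero.1 h, mem_closedBall, mem_sphere.1 hz] at hw
        exact absurd hw (not_le.2 hrR)
      refine Complex.circleIntegral_eq_zero_of_differentiable_on_off_countable hr.le
        countable_empty ((continuousOn_id.sub continuousOn_const).inv₀ hz') fun w hw => ?_
      exact (differentiableAt_id.sub_const z).inv (hz' w (ball_subset_closedBall hw.1))
    have h4 : CircleIntegrable (fun w => (w - z)⁻¹ • resolvent a z) c r :=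
      (hcinv.smul continuousOn_const).circleIntegrable hr.le
    have h5 : CircleIntegrable (fun w => (w - z)⁻¹ • resolvent a w) c r :=
      (hcinv.smul (continuousOn_resolvent hr')).circleIntegrable hr.le
    rw [h1, h2, circleIntegral.integral_sub h4 h5,
      circleIntegral.integral_smul_const, h3, zero_smul, zero_sub]
  calc (∮ z in C(c, R), resolvent a z) * (∮ w in C(c, r), resolvent a w)
      = ∮ z in C(c, R), resolvent a z * (∮ w in C(c, r), resolvent a w) :=
        (circleIntegral_clm_comp_comm ((ContinuousLinearMap.mul ℂ A).flip _) hIR).symm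
    _ = ∮ z in C(c, R), ∮ w in C(c, r), (z - w)⁻¹ • resolvent a w := by
        refine circleIntegral.integral_congr hR.le fun z hz => ?_
        rw [inner z hz, ← neg_one_smul ℂ, ← circleIntegral.integral_smul]
        refine circleIntegral.integral_congr hr.le fun w _ => ?_
        rw [smul_smul, ← neg_sub z w, inv_neg, neg_one_mul, neg_neg]
    _ = ∮ w in C(c, r), ∮ z in C(c, R), (z - w)⁻¹ • resolvent a w := by
        refine circleIntegral_swap hR.le hr.le ?_
        refine ContinuousOn.smul ?_ ?_
        · refine ContinuousOn.inv₀ (by fun_prop) fun q hq => ?_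
          rw [← neg_sub, neg_ne_zero]
          exact hne _ hq.1 _ hq.2
        · exact (continuousOn_resolvent hr').comp continuousOn_snd fun q hq => hq.2
    _ = ∮ w in C(c, r), (2 * (Real.pi : ℂ) * Complex.I) • resolvent a w := by
        refine circleIntegral.integral_congr hr.le fun w hw => ?_
        rw [circleIntegral.integral_smul_const, circleIntegral.integral_sub_inv_of_mem_ball]
        rw [mem_ball, mem_sphere.1 hw]
        exact hrR
    _ = _ := circleIntegral.integral_smul _ _ _ _

end Resolvent

theorem rieszProjection_eq_of_isIsolatingRadius {T : L2Z →L[ℂ] L2Z} {lam : ℂ} {r : ℝ}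
    (hr : IsIsolatingRadius T lam r) :
    rieszProjection T lam =
      (2 * (Real.pi : ℂ) * Complex.I)⁻¹ • ∮ z in C(lam, r), resolvent T z := by
  have h : ∃ r, IsIsolatingRadius T lam r := ⟨r, hr⟩
  have key : ∀ {r s : ℝ}, IsIsolatingRadius T lam r → IsIsolatingRadius T lam s → r ≤ s →
      (∮ z in C(lam, s), resolvent T z) = ∮ z in C(lam, r), resolvent T z := by
    intro r s hr hs hrs
    refine circleIntegral_resolvent_eq hr.1 hrs fun z hz hz' => hz.2 ?_
    have : z ∈ ({lam} : Set ℂ) := hs.2 ▸ ⟨hz.1, hz'⟩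
    rw [mem_singleton_iff.1 this]
    exact mem_ball_self hr.1
  rw [rieszProjection, dif_pos h]
  congr 1
  rcases le_total r h.choose with hle | hle
  · exact key hr h.choose_spec hle
  · exact (key h.choose_spec hr hle).symm

theorem IsIsolatingRadius.mono {T : L2Z →L[ℂ] L2Z} {lam : ℂ} {r s : ℝ}
    (hr : IsIsolatingRadius T lam r) (hs : 0 < s) (hsr : s ≤ r) : IsIsolatingRadius T lam s := by
  refine ⟨hs, Subset.antisymm ?_ ?_⟩
  · rw [← hr.2]
    exact inter_subset_inter_left _ (closedBall_subset_closedBall hsr)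
  · intro z hz
    rw [mem_singleton_iff.1 hz]
    refine ⟨mem_closedBall_self hs.le, ?_⟩
    have : lam ∈ closedBall lam r ∩ spectrum ℂ T := hr.2 ▸ mem_singleton lam
    exact this.2

theorem IsIsolatingRadius.notMem_spectrum {T : L2Z →L[ℂ] L2Z} {lam : ℂ} {r s : ℝ}
    (hr : IsIsolatingRadius T lam r) (hs : 0 < s) (hsr : s ≤ r) :
    ∀ z ∈ sphere lam s, z ∉ spectrum ℂ T := by
  intro z hz hz'
  have : z ∈ ({lam} : Set ℂ) := (hr.mono hs hsr).2 ▸ ⟨sphere_subset_closedBall hz, hz'⟩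
  rw [mem_singleton_iff.1 this, mem_sphere, dist_self] at hz
  exact hs.ne hz

/-- The Riesz projection is idempotent: write its two factors as integrals over circles of different
radii. -/
theorem rieszProjection_mul_self {T : L2Z →L[ℂ] L2Z} {lam : ℂ} {r : ℝ}
    (hr : IsIsolatingRadius T lam r) :
    rieszProjection T lam * rieszProjection T lam = rieszProjection T lam := by
  have hr2 : 0 < r / 2 := half_pos hr.1
  have hlt : r / 2 < r := half_lt_self hr.1
  have h2 := hr.mono hr2 hlt.le
  have hpi : (2 * (Real.pi : ℂ) * Complex.I) ≠ 0 := Complex.two_pi_I_ne_zero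
  conv_lhs =>
    rw [rieszProjection_eq_of_isIsolatingRadius hr]
    arg 2
    rw [← rieszProjection_eq_of_isIsolatingRadius hr, rieszProjection_eq_of_isIsolatingRadius h2]
  rw [rieszProjection_eq_of_isIsolatingRadius h2, smul_mul_smul_comm,
    circleIntegral_resolvent_mul hr2 hlt (hr.notMem_spectrum hr.1 le_rfl)
      (h2.notMem_spectrum hr2 le_rfl), smul_smul, mul_assoc, inv_mul_cancel₀ hpi, mul_one]

theorem rieszProjection_apply_eigenvector {T : L2Z →L[ℂ] L2Z} {lam : ℂ} {r : ℝ}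
    (hr : IsIsolatingRadius T lam r) {u : L2Z} (hu : T u = lam • u) :
    rieszProjection T lam u = u := by
  have hres : ∀ z ∈ sphere lam r, resolvent T z u = (z - lam)⁻¹ • u := by
    intro z hz
    have hz' := spectrum.notMem_iff.1 (hr.notMem_spectrum hr.1 le_rfl z hz)
    have hne : z - lam ≠ 0 := by
      intro h
      rw [sub_eq_zero.1 h, mem_sphere, dist_self] at hz
      exact hr.1.ne hz
    have h1 : resolvent T z ((algebraMap ℂ (L2Z →L[ℂ] L2Z) z - T) u) = u := by
      have := congrArg (fun S : L2Z →L[ℂ] L2Z => S u) (Ring.inverse_mul_cancel _ hz')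
      simpa [resolvent] using this
    have h2 : (algebraMap ℂ (L2Z →L[ℂ] L2Z) z - T) u = (z - lam) • u := by
      rw [sub_apply, hu, sub_smul, Algebra.algebraMap_eq_smul_one]
      rfl
    rw [h2, map_smul] at h1
    rw [eq_inv_smul_iff₀ hne, h1]
  have hI := circleIntegrable_resolvent hr.1.le (hr.notMem_spectrum hr.1 le_rfl)
  rw [rieszProjection_eq_of_isIsolatingRadius hr, smul_apply]
  have h3 : (∮ z in C(lam, r), resolvent T z) u = ∮ z in C(lam, r), resolvent T z u :=
    (circleIntegral_clm_comp_comm (ContinuousLinearMap.apply ℂ L2Z u) hI).symm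
  rw [h3, circleIntegral.integral_congr hr.1.le hres, circleIntegral.integral_smul_const,
    circleIntegral.integral_sub_center_inv _ hr.1.ne', smul_smul,
    inv_mul_cancel₀ Complex.two_pi_I_ne_zero, one_smul]

/-- If `lam` lies outside the spectrum of `T₀`, and `T - T₀` is compact, then the Riesz projection
of `T` at an isolated point `lam` of its spectrum is compact: it is the contour integral of the
difference of the resolvents of `T` and `T₀`. A compact projection has finite rank. -/
theorem finiteDimensional_range_rieszProjection {T T₀ : L2Z →L[ℂ] L2Z} {lam : ℂ} {r : ℝ}
    (hr : IsIsolatingRadius T lam r) (hlam : lam ∉ spectrum ℂ T₀)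
    (hK : IsCompactOperator (T - T₀)) :
    FiniteDimensional ℂ (LinearMap.range (rieszProjection T lam : L2Z →ₗ[ℂ] L2Z)) := by
  obtain ⟨s, hs, hs0⟩ : ∃ s > 0, ∀ z ∈ closedBall lam s, z ∉ spectrum ℂ T₀ := by
    have : (spectrum ℂ T₀)ᶜ ∈ nhds lam := (spectrum.isClosed T₀).isOpen_compl.mem_nhds hlam
    exact nhds_basis_closedBall.mem_iff.1 this
  set t := min r s
  have ht : 0 < t := lt_min hr.1 hs
  have htr := hr.mono ht (min_le_left r s)
  have ht0 : ∀ z ∈ closedBall lam t, z ∉ spectrum ℂ T₀ := fun z hz =>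
    hs0 z (closedBall_subset_closedBall (min_le_right r s) hz)
  have ht1 := htr.notMem_spectrum ht le_rfl
  have hI := circleIntegrable_resolvent ht.le ht1
  have hI0 := circleIntegrable_resolvent ht.le fun z hz => ht0 z (sphere_subset_closedBall hz)
  have hmem : (∮ z in C(lam, t), resolvent T z) ∈
      compactOperator (RingHom.id ℂ) L2Z L2Z := by
    rw [← sub_zero (∮ z in C(lam, t), resolvent T z),
      ← circleIntegral_resolvent_eq_zero ht.le ht0, ← circleIntegral.integral_sub hI hI0]
    refine circleIntegral_mem_of_isClosed _ isClosed_setOfPred_isCompactOperator ht.le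
      (hI.sub hI0) fun z hz => ?_
    rw [spectrum.resolvent_sub_resolvent (spectrum.notMem_iff.1 (ht1 z hz))
      (spectrum.notMem_iff.1 (ht0 z (sphere_subset_closedBall hz)))]
    exact (hK.clm_comp (resolvent T z)).comp_clm (resolvent T₀ z)
  have hP : IsCompactOperator (rieszProjection T lam) := by
    rw [rieszProjection_eq_of_isIsolatingRadius htr]
    exact Submodule.smul_mem (compactOperator (RingHom.id ℂ) L2Z L2Z) _ hmem
  have hfin := ContinuousLinearMap.finite_dimensional_eigenspace hP 1 one_ne_zero
  refine Submodule.finiteDimensional_of_le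
    (S₂ := Module.End.eigenspace (rieszProjection T lam : L2Z →ₗ[ℂ] L2Z) (1 : ℂ)) ?_
  rintro _ ⟨u, rfl⟩
  rw [Module.End.mem_eigenspace_iff, one_smul]
  exact congrArg (fun S : L2Z →L[ℂ] L2Z => S u) (rieszProjection_mul_self hr)

end Jacobi

/-! ### The spectrum of a Schrödinger operator with finitely supported potential -/

namespace Jacobi

open Metric Set Filter Topology

theorem coe_one_bddSeq (n : ℤ) : (1 : BddSeq) n = 1 := rfl

theorem isClosed_freeSpectrum : IsClosed freeSpectrum :=
  (isCompact_Icc.image Complex.continuous_ofReal).isClosed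

theorem norm_shiftOp_le (k : ℤ) : ‖shiftOp k‖ ≤ 1 :=
  LinearMap.mkContinuous_norm_le _ zero_le_one _

theorem shiftOp_apply (k : ℤ) (u : L2Z) (n : ℤ) : shiftOp k u n = u (n + k) := rfl

theorem inner_shiftOp_left (k : ℤ) (u w : L2Z) :
    inner ℂ (shiftOp k u) w = inner ℂ u (shiftOp (-k) w) := by
  rw [lp.inner_eq_tsum, lp.inner_eq_tsum, ← (Equiv.addRight k).tsum_eq
    (fun n => inner ℂ (u n) (shiftOp (-k) w n))]
  simp [shiftOp_apply]

theorem jacobiOp_free : jacobiOp 1 0 1 = shiftOp (-1) + shiftOp 1 := by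
  ext u n
  rw [jacobiOp_apply]
  simp [coe_one_bddSeq, shiftOp_apply, sub_eq_add_neg]

theorem isSelfAdjoint_jacobiOp_free : IsSelfAdjoint (jacobiOp 1 0 1) := by
  rw [ContinuousLinearMap.isSelfAdjoint_iff_isSymmetric, jacobiOp_free]
  intro u w
  simp only [ContinuousLinearMap.coe_coe, add_apply, inner_add_left, inner_add_right,
    inner_shiftOp_left, neg_neg]
  exact add_comm _ _

theorem spectrum_jacobiOp_free_subset : spectrum ℂ (jacobiOp 1 0 1) ⊆ freeSpectrum := by
  intro z hz
  have hre := isSelfAdjoint_jacobiOp_free.mem_spectrum_eq_re hz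
  have hnorm : ‖jacobiOp 1 0 1‖ ≤ 2 := by
    rw [jacobiOp_free]
    calc _ ≤ ‖shiftOp (-1)‖ + ‖shiftOp 1‖ := norm_add_le _ _
      _ ≤ 1 + 1 := add_le_add (norm_shiftOp_le _) (norm_shiftOp_le _)
      _ = 2 := by norm_num
  refine ⟨z.re, ?_, hre.symm⟩
  have : |z.re| ≤ 2 := ((Complex.abs_re_le_norm z).trans
    (spectrum.norm_le_norm_mul_of_mem hz)).trans ((mul_le_of_le_one_right (norm_nonneg _)
      ContinuousLinearMap.norm_id_le).trans hnorm)
  exact abs_le.1 this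

theorem jacobiOp_one_one_sub (b : BddSeq) : jacobiOp 1 b 1 - jacobiOp 1 0 1 = diagOp b := by
  ext u n
  simp only [sub_apply, lp.coeFn_sub, Pi.sub_apply, jacobiOp_apply]
  simp [diagOp]

theorem isCompactOperator_diagOp {b : BddSeq} {s : Finset ℤ} (hb : ∀ k ∉ s, b k = 0) :
    IsCompactOperator (diagOp b) := by
  have h : diagOp b = ∑ k ∈ s, (b k) •
      ((lp.lsingle (𝕜 := ℂ) (E := fun _ : ℤ => ℂ) 2 k).toContinuousLinearMap ∘L
        lp.evalCLM ℂ (fun _ : ℤ => ℂ) 2 k) := by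
    ext u n
    have h1 : diagOp b u n = b n * u n := rfl
    rw [h1, sum_apply, lp.coeFn_sum, Finset.sum_apply]
    have h2 : ∀ k, ((b k) • ((lp.lsingle (𝕜 := ℂ) (E := fun _ : ℤ => ℂ) 2 k).toContinuousLinearMap
        ∘L lp.evalCLM ℂ (fun _ : ℤ => ℂ) 2 k)) u n = b k * Pi.single (M := fun _ : ℤ => ℂ) k (u k) n :=
      fun k => rfl
    simp only [h2]
    by_cases hn : n ∈ s
    · rw [Finset.sum_eq_single n (fun k _ hk => by simp [Pi.single_eq_of_ne hk.symm])
        (fun h => absurd hn h)]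
      simp
    · rw [hb n hn, zero_mul, Finset.sum_eq_zero]
      intro k hk
      have : n ≠ k := fun h => hn (h ▸ hk)
      simp [Pi.single_eq_of_ne this]
  rw [h]
  refine Submodule.sum_mem (compactOperator (RingHom.id ℂ) L2Z L2Z) fun k _ => ?_
  refine Submodule.smul_mem (compactOperator (RingHom.id ℂ) L2Z L2Z) _ ?_
  exact isCompactOperator_of_locallyCompactSpace_rng
    (lp.lsingle (𝕜 := ℂ) (E := fun _ : ℤ => ℂ) 2 k).toContinuousLinearMap |>.comp_clm _

/-- Outside the spectrum of `T₀`, a compact perturbation `T` of `T₀` has no spectrum but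
eigenvalues: the Fredholm alternative applies to `(z - T₀)⁻¹ (T - T₀)`. -/
theorem hasEigenvalue_of_mem_spectrum {T T₀ : L2Z →L[ℂ] L2Z} {z : ℂ}
    (hK : IsCompactOperator (T - T₀)) (hz₀ : z ∉ spectrum ℂ T₀) (hz : z ∈ spectrum ℂ T) :
    ∃ u : L2Z, u ≠ 0 ∧ T u = z • u := by
  have hz' : IsUnit (algebraMap ℂ (L2Z →L[ℂ] L2Z) z - T₀) := spectrum.notMem_iff.1 hz₀
  set S := algebraMap ℂ (L2Z →L[ℂ] L2Z) z - T₀ with hS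
  have hSR : S * resolvent T₀ z = 1 := Ring.mul_inverse_cancel _ hz'
  have hfac : algebraMap ℂ (L2Z →L[ℂ] L2Z) z - T = S * (1 - resolvent T₀ z * (T - T₀)) := by
    rw [mul_sub, ← mul_assoc, hSR, mul_one, one_mul, hS]
    abel
  have hcomp : IsCompactOperator (resolvent T₀ z * (T - T₀)) := hK.clm_comp _
  rcases hcomp.hasEigenvalue_or_mem_resolventSet one_ne_zero with h | h
  · obtain ⟨u, hu⟩ := h.exists_hasEigenvector
    refine ⟨u, hu.2, ?_⟩
    have h1 : (1 - resolvent T₀ z * (T - T₀)) u = 0 := by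
      have := hu.apply_eq_smul
      rw [one_smul] at this
      rw [sub_apply]
      exact sub_eq_zero.2 this.symm
    have h2 := congrArg (fun L : L2Z →L[ℂ] L2Z => L u) hfac
    rw [mul_apply_eq_comp, h1, map_zero, sub_apply, sub_eq_zero,
      Algebra.algebraMap_eq_smul_one] at h2
    exact h2.symm
  · exfalso
    have h1 : IsUnit (1 - resolvent T₀ z * (T - T₀)) := by
      simpa using spectrum.mem_resolventSet_iff.1 h
    exact hz (spectrum.mem_resolventSet_iff.2 (hfac ▸ hz'.mul h1))

/-- The Joukowski parametrization of the complement of `[-2, 2]`. -/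
theorem exists_joukowski {z : ℂ} (hz : z ∉ freeSpectrum) :
    ∃ k : ℂ, k ≠ 0 ∧ ‖k‖ < 1 ∧ z = k + k⁻¹ := by
  obtain ⟨k, hk⟩ : ∃ k : ℂ, 1 * (k * k) + (-z) * k + 1 = 0 := by
    refine exists_quadratic_eq_zero one_ne_zero ?_
    obtain ⟨s, hs⟩ := IsAlgClosed.exists_pow_nat_eq (discrim 1 (-z) 1) two_pos
    exact ⟨s, by rw [← hs, sq]⟩
  have hk0 : k ≠ 0 := by
    rintro rfl
    simp at hk
  have hzk : z = k + k⁻¹ := by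
    field_simp
    linear_combination -hk
  rcases lt_trichotomy ‖k‖ 1 with h | h | h
  · exact ⟨k, hk0, h, hzk⟩
  · exfalso
    apply hz
    refine ⟨2 * k.re, ?_, ?_⟩
    · have := abs_le.1 ((Complex.abs_re_le_norm k).trans h.le)
      constructor <;> linarith [this.1, this.2]
    · rw [hzk, Complex.inv_eq_conj h, Complex.add_conj]
  · exact ⟨k⁻¹, inv_ne_zero hk0, by rw [norm_inv]; exact inv_lt_one_of_one_lt₀ h,
      by rw [inv_inv, add_comm]; exact hzk⟩

/-- A solution of the free recurrence that tends to zero is geometric. -/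
theorem eq_mul_of_tendsto_zero {k : ℂ} (hk0 : k ≠ 0) (hk1 : ‖k‖ < 1) {x : ℕ → ℂ}
    (hx : Tendsto x atTop (𝓝 0)) (hrec : ∀ m, x (m + 2) + x m = (k + k⁻¹) * x (m + 1)) :
    x 1 = k * x 0 := by
  have hstep : ∀ m, k ^ m * (x (m + 1) - k * x m) = x 1 - k * x 0 := by
    intro m
    induction m with
    | zero => simp
    | succ m ih =>
      rw [← ih, pow_succ]
      have h := hrec m
      have h' : k * (x (m + 2) - k * x (m + 1)) = x (m + 1) - k * x m := by
        have : x (m + 2) = (k + k⁻¹) * x (m + 1) - x m := by linear_combination h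
        rw [this]
        field_simp
        ring
      linear_combination k ^ m * h'
  have hlim : Tendsto (fun m => k ^ m * (x (m + 1) - k * x m)) atTop (𝓝 (0 * (0 - k * 0))) :=
    (tendsto_pow_atTop_nhds_zero_of_norm_lt_one hk1).mul
      (((tendsto_add_atTop_iff_nat 1).2 hx).sub (hx.const_mul k))
  simp only [hstep] at hlim
  have := tendsto_nhds_unique hlim tendsto_const_nhds
  rw [zero_mul] at this
  linear_combination -this

theorem tendsto_cofinite_zero_L2Z (u : L2Z) : Tendsto (fun n : ℤ => u n) cofinite (𝓝 0) := by
  have h := (lp.memℓp u).summable (by norm_num)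
  have h1 := h.tendsto_cofinite_zero
  have h2 : Tendsto (fun n : ℤ => (‖u n‖ ^ (2 : ℝ≥0∞).toReal) ^ (1 / 2 : ℝ)) cofinite
      (𝓝 (0 ^ (1 / 2 : ℝ))) := h1.rpow_const (by norm_num)
  rw [tendsto_zero_iff_norm_tendsto_zero]
  convert h2 using 2
  · rw [← Real.rpow_mul (norm_nonneg _)]
    norm_num
  · norm_num

open Polynomial in
/-- The polynomials `k ^ (j - 1) u_j`, where `u` is the solution of the eigenvalue equation for
`lam = k + k⁻¹` that satisfies `u_0 = k` and `u_1 = 1`. -/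
noncomputable def jostPoly (b : ℤ → ℂ) : ℕ → ℂ[X]
  | 0 => 1
  | 1 => 1
  | j + 2 => (X ^ 2 + 1 - C (b (j + 1)) * X) * jostPoly b (j + 1) - X ^ 2 * jostPoly b j

theorem eval_zero_jostPoly (b : ℤ → ℂ) (j : ℕ) : (jostPoly b j).eval 0 = 1 := by
  induction j using Nat.twoStepInduction with
  | zero => simp [jostPoly]
  | one => simp [jostPoly]
  | more j _ ih => simp [jostPoly, ih]

/-- A Schrödinger operator whose potential is supported in `{1, …, n}` has only finitely many
points of the spectrum outside `[-2, 2]`, as they are images of roots of one polynomial. -/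
theorem finite_spectrum_diff_freeSpectrum {b : BddSeq} {n : ℕ}
    (hb : ∀ k : ℤ, ¬ (1 ≤ k ∧ k ≤ n) → b k = 0) :
    (spectrum ℂ (jacobiOp 1 b 1) \ freeSpectrum).Finite := by
  classical
  set D : Polynomial ℂ := jostPoly b (n + 1) - Polynomial.X ^ 2 * jostPoly b n
  -- the equation `u_{n+1} = k u_n` says that `k` is a root of `D`
  have hD : D ≠ 0 := by
    intro h
    have := congrArg (Polynomial.eval 0) h
    simp [D, eval_zero_jostPoly] at this
  refine ((D.roots.toFinset.finite_toSet).image fun k : ℂ => k + k⁻¹).subset ?_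
  rintro z ⟨hz, hzfree⟩
  have hK : IsCompactOperator (jacobiOp 1 b 1 - jacobiOp 1 0 1) := by
    rw [jacobiOp_one_one_sub]
    refine isCompactOperator_diagOp (s := Finset.Icc 1 (n : ℤ)) fun k hk => hb k ?_
    simpa using hk
  obtain ⟨u, hu0, hu⟩ := hasEigenvalue_of_mem_spectrum hK
    (fun h => hzfree (spectrum_jacobiOp_free_subset h)) hz
  obtain ⟨k, hk0, hk1, rfl⟩ := exists_joukowski hzfree
  have hrec : ∀ m : ℤ, u (m - 1) + b m * u m + u (m + 1) = (k + k⁻¹) * u m := by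
    intro m
    have h := congrArg (fun w : L2Z => w m) hu
    dsimp only at h
    rw [jacobiOp_apply] at h
    simpa [coe_one_bddSeq] using h
  have htend : ∀ f : ℕ → ℤ, Function.Injective f → Tendsto (fun m => u (f m)) atTop (𝓝 0) :=
    fun f hf => by
      rw [← Nat.cofinite_eq_atTop]
      exact (tendsto_cofinite_zero_L2Z u).comp hf.tendsto_cofinite
  -- decay on the left
  have hleft : ∀ m : ℕ, u (-m) = k * u (1 - m) := by
    intro m
    have := eq_mul_of_tendsto_zero hk0 hk1 (x := fun i : ℕ => u (1 - m - i))
      (htend _ fun i j hij => by simpa using hij) (fun i => by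
        have h := hrec (-m - i)
        rw [hb _ (by omega)] at h
        have e1 : (1 - m - (i + 2 : ℕ) : ℤ) = -m - i - 1 := by push_cast; ring
        have e2 : (1 - m - i : ℤ) = -m - i + 1 := by ring
        have e3 : (1 - m - (i + 1 : ℕ) : ℤ) = -m - i := by push_cast; ring
        rw [e1, e2, e3]
        linear_combination h)
    simpa using this
  -- decay on the right
  have hright : u (n + 1) = k * u n := by
    have := eq_mul_of_tendsto_zero hk0 hk1 (x := fun i : ℕ => u (n + i))
      (htend _ fun i j hij => by simpa using hij) (fun i => by
        have h := hrec (n + i + 1)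
        rw [hb _ (by omega)] at h
        have e1 : (n + (i + 2 : ℕ) : ℤ) = n + i + 1 + 1 := by push_cast; ring
        have e2 : (n + i : ℤ) = n + i + 1 - 1 := by ring
        have e3 : (n + (i + 1 : ℕ) : ℤ) = n + i + 1 := by push_cast; ring
        rw [e1, e3]
        nth_rewrite 2 [e2]
        linear_combination h)
    simpa using this
  have hpoly : ∀ j : ℕ, k ^ j * u j = k * (jostPoly b j).eval k * u 1 := by
    intro j
    induction j using Nat.twoStepInduction with
    | zero => simpa [jostPoly] using hleft 0
    | one => simp [jostPoly]
    | more j ih0 ih1 =>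
      have h := hrec (j + 1)
      have e : u (j + 2 : ℕ) = (k + k⁻¹) * u (j + 1) - b (j + 1) * u (j + 1) - u j := by
        push_cast
        have e2 : (j + 1 - 1 : ℤ) = j := by ring
        rw [e2] at h
        linear_combination h
      have e' : k ^ (j + 2) * u (j + 2 : ℕ) =
          (k ^ 2 + 1 - b (j + 1) * k) * (k ^ (j + 1) * u (j + 1)) - k ^ 2 * (k ^ j * u j) := by
        rw [e]
        field_simp
        ring
      push_cast at ih1
      rw [e', ih0, ih1]
      simp only [jostPoly, Polynomial.eval_sub, Polynomial.eval_mul, Polynomial.eval_add,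
        Polynomial.eval_pow, Polynomial.eval_X, Polynomial.eval_one, Polynomial.eval_C]
      ring
  have hu1 : u 1 ≠ 0 := by
    intro h1
    apply hu0
    ext m
    rcases le_or_gt 0 m with hm | hm
    · obtain ⟨j, rfl⟩ := Int.eq_ofNat_of_zero_le hm
      have := hpoly j
      rw [h1, mul_zero, mul_eq_zero] at this
      exact this.resolve_left (pow_ne_zero _ hk0)
    · obtain ⟨j, rfl⟩ : ∃ j : ℕ, m = -j := ⟨m.natAbs, by omega⟩
      clear hm
      have : ∀ j : ℕ, u (1 - j) = 0 := by
        intro j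
        induction j with
        | zero => simpa using h1
        | succ j ih =>
          have := hleft j
          rw [ih, mul_zero] at this
          have e : (1 - (j + 1 : ℕ) : ℤ) = -j := by push_cast; ring
          rw [e, this]
      rw [hleft j, this j, mul_zero]
      rfl
  refine ⟨k, ?_, rfl⟩
  rw [Finset.mem_coe, Multiset.mem_toFinset, Polynomial.mem_roots hD, Polynomial.IsRoot]
  have h1 := hpoly (n + 1)
  have h0 := hpoly n
  push_cast at h1
  rw [hright] at h1
  have : k * u 1 * D.eval k = 0 := by
    simp only [D, Polynomial.eval_sub, Polynomial.eval_mul, Polynomial.eval_pow, Polynomial.eval_X]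
    linear_combination -h1 + k ^ 2 * h0
  exact (mul_eq_zero.1 this).resolve_left (mul_ne_zero hk0 hu1)

/-- An eigenvalue outside `[-2, 2]` is discrete. -/
theorem mem_discreteSpectrum_of_eigenvector {b : BddSeq} {n : ℕ}
    (hb : ∀ k : ℤ, ¬ (1 ≤ k ∧ k ≤ n) → b k = 0) {lam : ℂ} (hlam : lam ∉ freeSpectrum)
    {u : L2Z} (hu0 : u ≠ 0) (hu : jacobiOp 1 b 1 u = lam • u) :
    lam ∈ discreteSpectrum (jacobiOp 1 b 1) ∧ 1 ≤ algMultiplicity (jacobiOp 1 b 1) lam := by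
  have hK : IsCompactOperator (jacobiOp 1 b 1 - jacobiOp 1 0 1) := by
    rw [jacobiOp_one_one_sub]
    refine isCompactOperator_diagOp (s := Finset.Icc 1 (n : ℤ)) fun k hk => hb k ?_
    simpa using hk
  have hev : Module.End.HasEigenvalue (jacobiOp 1 b 1 : L2Z →ₗ[ℂ] L2Z) lam :=
    Module.End.hasEigenvalue_of_hasEigenvector (x := u)
      ⟨Module.End.mem_eigenspace_iff.2 hu, hu0⟩
  have hspec : lam ∈ spectrum ℂ (jacobiOp 1 b 1) := by
    rw [ContinuousLinearMap.spectrum_eq]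
    exact hev.mem_spectrum
  obtain ⟨r, hr⟩ : ∃ r, IsIsolatingRadius (jacobiOp 1 b 1) lam r := by
    set F := freeSpectrum ∪ ((spectrum ℂ (jacobiOp 1 b 1) \ freeSpectrum) \ {lam})
    have hF : IsClosed F := isClosed_freeSpectrum.union
      ((finite_spectrum_diff_freeSpectrum hb).subset sdiff_subset).isClosed
    have hlF : lam ∉ F := by
      rintro (h | h)
      · exact hlam h
      · exact h.2 rfl
    obtain ⟨r, hr, hrF⟩ := nhds_basis_closedBall.mem_iff.1 (hF.isOpen_compl.mem_nhds hlF)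
    refine ⟨r, hr, Subset.antisymm ?_ ?_⟩
    · rintro z ⟨hz, hz'⟩
      by_contra hne
      refine hrF hz ?_
      by_cases h : z ∈ freeSpectrum
      · exact Or.inl h
      · exact Or.inr ⟨⟨hz', h⟩, hne⟩
    · intro z hz
      rw [mem_singleton_iff.1 hz]
      exact ⟨mem_closedBall_self hr.le, hspec⟩
  have hfin := finiteDimensional_range_rieszProjection hr
    (fun h => hlam (spectrum_jacobiOp_free_subset h)) hK
  refine ⟨⟨⟨r, hr⟩, hev, hfin⟩, ?_⟩
  rw [algMultiplicity, Nat.one_le_iff_ne_zero, ← Nat.pos_iff_ne_zero,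
    Module.finrank_pos_iff_exists_ne_zero]
  exact ⟨⟨u, u, rieszProjection_apply_eigenvector hr hu⟩, fun h => hu0 (congrArg Subtype.val h)⟩

end Jacobi

/-! ### Eigenvectors for a constant potential on `{1, …, n}` -/

namespace Jacobi

open Set

/-- The eigenvector for a potential equal to a constant on `{1, …, n}`: a decaying exponential
in `k` on either side of the support, and a combination of `w ^ j` and `w ^ (-j)` on the support. -/
noncomputable def wellVector (n : ℕ) (w e s k : ℂ) (j : ℤ) : ℂ :=
  if j ≤ 0 then (w + e) * k ^ (1 - j)
  else if j ≤ n then w ^ j + e * w ^ (1 - j)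
  else s * (w + e) * k ^ (j - n)

section WellVector

variable {n : ℕ} {w e s k : ℂ}

/-- The exponential on the left also agrees with the vector at the site `1`, where the matching
with the middle part takes place; similarly for `wellVector_right` and the site `n`. -/
theorem wellVector_left (hn : 1 ≤ n) {j : ℤ} (hj : j ≤ 1) :
    wellVector n w e s k j = (w + e) * k ^ (1 - j) := by
  rcases hj.lt_or_eq with h | rfl
  · rw [wellVector, if_pos (by omega)]
  · rw [wellVector, if_neg (by omega), if_pos (by omega)]
    simp

theorem wellVector_right (hn : 1 ≤ n) (hw : w ≠ 0) (hs : s * s = 1) (he : e = s * w ^ n) {j : ℤ}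
    (hj : n ≤ j) : wellVector n w e s k j = s * (w + e) * k ^ (j - n) := by
  rcases hj.lt_or_eq with h | rfl
  · rw [wellVector, if_neg (by omega), if_neg (by omega)]
  · rw [wellVector, if_neg (by omega), if_pos (by omega), zpow_sub₀ hw, he]
    simp only [zpow_one, zpow_natCast, sub_self, zpow_zero, mul_one]
    field_simp
    linear_combination -w ^ n * hs

theorem wellVector_mid (hn : 1 ≤ n) (hw : w ≠ 0) (hs : s * s = 1) (he : e = s * w ^ n)
    (hk : k * (w + e) = 1 + e * w) {j : ℤ}
    (hj0 : 0 ≤ j) (hj : j ≤ n + 1) : wellVector n w e s k j = w ^ j + e * w ^ (1 - j) := by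
  rcases hj0.lt_or_eq with h | rfl
  · rcases hj.lt_or_eq with h' | rfl
    · rw [wellVector, if_neg (by omega), if_pos (by omega)]
    · have e1 : ((n : ℤ) + 1 - n) = 1 := by ring
      have e2 : (1 - ((n : ℤ) + 1)) = -n := by ring
      rw [wellVector_right hn hw hs he (by omega), e1, e2, zpow_one, zpow_neg, zpow_add_one₀ hw]
      simp only [zpow_natCast]
      have h3 : e * (w ^ n)⁻¹ = s := by rw [he]; field_simp
      rw [h3]
      linear_combination s * hk + s * w * he + w * w ^ n * hs
  · rw [wellVector_left hn (by omega)]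
    simp only [sub_zero, zpow_one, zpow_zero]
    linear_combination hk

theorem memLp_wellVector (hn : 1 ≤ n) (hw : w ≠ 0) (hs : s * s = 1) (he : e = s * w ^ n)
    (hk1 : ‖k‖ < 1) : Memℓp (wellVector n w e s k) 2 := by
  rw [memℓp_gen_iff (by norm_num)]
  have hgeo : ∀ C : ℂ, Summable fun j : ℕ => ‖C * k ^ j‖ ^ (2 : ℝ≥0∞).toReal := by
    intro C
    have h : (fun j : ℕ => ‖C * k ^ j‖ ^ (2 : ℝ≥0∞).toReal) =
        fun j => ‖C‖ ^ 2 * (‖k‖ ^ 2) ^ j := by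
      ext j
      simp only [ENNReal.toReal_ofNat, Real.rpow_ofNat, norm_mul, norm_pow]
      ring
    rw [h]
    exact (summable_geometric_of_lt_one (by positivity)
      (pow_lt_one₀ (norm_nonneg k) hk1 two_ne_zero)).mul_left _
  refine Summable.of_nat_of_neg ?_ ?_
  · rw [← summable_nat_add_iff n]
    refine (hgeo (s * (w + e))).congr fun j => ?_
    rw [wellVector_right hn hw hs he (by push_cast; omega)]
    simp
  · refine (hgeo ((w + e) * k)).congr fun j => ?_
    have : (1 - -(j : ℤ)) = (j + 1 : ℕ) := by push_cast; ring
    rw [wellVector_left hn (by omega), this, zpow_natCast, pow_succ', mul_assoc]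

theorem wellVector_recurrence (hn : 1 ≤ n) (hw : w ≠ 0) (hk0 : k ≠ 0) (hs : s * s = 1)
    (he : e = s * w ^ n) (hk : k * (w + e) = 1 + e * w) {v : ℂ}
    (hv : k + k⁻¹ = w + w⁻¹ + v) (j : ℤ) :
    wellVector n w e s k (j - 1) + (if 1 ≤ j ∧ j ≤ n then v else 0) * wellVector n w e s k j +
      wellVector n w e s k (j + 1) = (k + k⁻¹) * wellVector n w e s k j := by
  rcases le_or_gt j 0 with h | h
  · rw [if_neg (by omega), wellVector_left hn (by omega), wellVector_left hn (by omega),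
      wellVector_left hn (by omega)]
    have e1 : 1 - (j - 1) = -j + 1 + 1 := by ring
    have e2 : 1 - (j + 1) = -j := by ring
    have e3 : 1 - j = -j + 1 := by ring
    rw [e1, e2, e3, zpow_add_one₀ hk0, zpow_add_one₀ hk0]
    field_simp
    ring
  · rcases le_or_gt j n with h' | h'
    · rw [if_pos ⟨by omega, h'⟩, hv, wellVector_mid hn hw hs he hk (by omega) (by omega),
        wellVector_mid hn hw hs he hk (by omega) (by omega),
        wellVector_mid hn hw hs he hk (by omega) (by omega)]
      have e1 : 1 - (j - 1) = -j + 1 + 1 := by ring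
      have e2 : 1 - (j + 1) = -j := by ring
      have e3 : 1 - j = -j + 1 := by ring
      rw [e1, e2, e3, zpow_add_one₀ hw, zpow_add_one₀ hw, zpow_add_one₀ hw, zpow_sub_one₀ hw]
      field_simp
      ring
    · rw [if_neg (by omega), wellVector_right hn hw hs he (by omega),
        wellVector_right hn hw hs he (by omega), wellVector_right hn hw hs he (by omega)]
      have e1 : j - 1 - n = j - n - 1 := by ring
      have e2 : j + 1 - n = j - n + 1 := by ring
      rw [e1, e2, zpow_add_one₀ hk0, zpow_sub_one₀ hk0]
      field_simp
      ring

end WellVector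

theorem notMem_freeSpectrum_of_im_pos {lam : ℂ} (h : 0 < lam.im) : lam ∉ freeSpectrum := by
  rintro ⟨x, -, rfl⟩
  simp at h

/-- A solution of the secular equation yields a discrete eigenvalue. The sign conditions select
the solution `k` of `k + k⁻¹ = lam` with `‖k‖ < 1`. -/
theorem mem_discreteSpectrum_of_secular {n : ℕ} (hn : 1 ≤ n) {b : BddSeq} {v : ℂ}
    (hb : ∀ j : ℤ, b j = if 1 ≤ j ∧ j ≤ n then v else 0) {w e s : ℂ} (hw1 : ‖w‖ < 1)
    (he1 : ‖e‖ < 1) (hwim : 0 < w.im) (heim : 0 < e.im) (hs : s * s = 1) (he : e = s * w ^ n)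
    (hsec : e * (w - w⁻¹) ^ 2 = -v * ((1 + e * w) * (1 + e * w⁻¹)))
    (hlam : 0 < (w + w⁻¹ + v).im) :
    w + w⁻¹ + v ∈ discreteSpectrum (jacobiOp 1 b 1) ∧
      1 ≤ algMultiplicity (jacobiOp 1 b 1) (w + w⁻¹ + v) := by
  have hw : w ≠ 0 := by rintro rfl; simp at hwim
  have hwe : w + e ≠ 0 := by
    intro h
    have := congrArg Complex.im h
    simp at this
    linarith
  have hwe' : 1 + e * w ≠ 0 := by
    intro h
    have h1 : ‖e * w‖ = 1 := by
      rw [show e * w = -1 by linear_combination h]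
      simp
    rw [norm_mul] at h1
    nlinarith [norm_nonneg e, norm_nonneg w]
  -- matching at the sites `0` and `1`
  set k := (1 + e * w) / (w + e) with hkdef
  have hk : k * (w + e) = 1 + e * w := div_mul_cancel₀ _ hwe
  have hk0 : k ≠ 0 := div_ne_zero hwe' hwe
  have hv : k + k⁻¹ = w + w⁻¹ + v := by
    rw [hkdef]
    field_simp at hsec ⊢
    linear_combination -hsec
  have hkim : k.im < 0 := by
    have h1 : k.im * Complex.normSq (w + e) = ((1 + e * w) * (starRingEnd ℂ) (w + e)).im := by
      rw [← hk, mul_assoc, Complex.mul_conj, Complex.im_mul_ofReal]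
    have h2 : ((1 + e * w) * (starRingEnd ℂ) (w + e)).im =
        -((1 - Complex.normSq e) * w.im + (1 - Complex.normSq w) * e.im) := by
      simp only [Complex.mul_im, Complex.add_re, Complex.add_im, Complex.one_re, Complex.one_im,
        Complex.mul_re, Complex.conj_re, Complex.conj_im, Complex.normSq_apply]
      ring
    have h3 : 0 < Complex.normSq (w + e) := Complex.normSq_pos.2 hwe
    have h4 : Complex.normSq e < 1 := by
      rw [Complex.normSq_eq_norm_sq]
      exact pow_lt_one₀ (norm_nonneg _) he1 two_ne_zero
    have h5 : Complex.normSq w < 1 := by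
      rw [Complex.normSq_eq_norm_sq]
      exact pow_lt_one₀ (norm_nonneg _) hw1 two_ne_zero
    rw [h2] at h1
    have h6 : 0 < (1 - Complex.normSq e) * w.im := mul_pos (by linarith) hwim
    have h7 : 0 < (1 - Complex.normSq w) * e.im := mul_pos (by linarith) heim
    by_contra! h
    nlinarith [mul_nonneg h h3.le]
  -- `Im (k + k⁻¹) = Im k (1 - ‖k‖⁻²)` is positive and `Im k` is negative
  have hk1 : ‖k‖ < 1 := by
    have h3 : 0 < Complex.normSq k := Complex.normSq_pos.2 hk0
    rw [← hv, Complex.add_im, Complex.inv_im] at hlam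
    by_contra! h
    have h1 : 1 ≤ Complex.normSq k := by
      rw [Complex.normSq_eq_norm_sq]
      exact one_le_pow₀ h
    have h2 : -k.im / Complex.normSq k ≤ -k.im := div_le_self (by linarith) h1
    linarith
  set u : L2Z := ⟨wellVector n w e s k, memLp_wellVector hn hw hs he hk1⟩ with hu
  have hcoe : ∀ j, u j = wellVector n w e s k j := fun j => rfl
  rw [← hv]
  refine mem_discreteSpectrum_of_eigenvector (n := n) (u := u)
    (fun j hj => by rw [hb, if_neg hj]) (notMem_freeSpectrum_of_im_pos (hv ▸ hlam)) ?_ ?_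
  · intro h
    have h1 : u 1 = 0 := by rw [h]; rfl
    rw [hcoe, wellVector_left hn le_rfl] at h1
    simp [hwe] at h1
  · ext j
    rw [jacobiOp_apply, hb, coe_one_bddSeq, coe_one_bddSeq, one_mul, one_mul]
    exact wellVector_recurrence hn hw hk0 hs he hk hv j

end Jacobi

/-! ### Solutions of the secular equation -/

namespace Jacobi

open Complex Metric

theorem norm_sin_add_sub_sin_le (x : ℝ) {y : ℂ} (hy : ‖y‖ ≤ 1) :
    ‖sin (x + y) - sin x‖ ≤ 2 * ‖y‖ := by
  have h : sin (x + y) - sin x = (exp (-x * I) * (exp (-y * I) - 1) -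
      exp (x * I) * (exp (y * I) - 1)) * (I / 2) := by
    simp only [sin, mul_sub, mul_one, ← exp_add]
    ring_nf
  have h1 : ‖exp (-x * I)‖ = 1 := by
    rw [← ofReal_neg, norm_exp_ofReal_mul_I]
  have h2 : ‖exp (-y * I) - 1‖ ≤ 2 * ‖y‖ := by
    have := Complex.norm_exp_sub_one_le (x := -y * I) (by simpa using hy)
    simpa using this
  have h3 : ‖exp (y * I) - 1‖ ≤ 2 * ‖y‖ := by
    have := Complex.norm_exp_sub_one_le (x := y * I) (by simpa using hy)
    simpa using this
  rw [h, norm_mul]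
  have h4 : ‖I / 2‖ = 1 / 2 := by simp
  rw [h4]
  have h5 := norm_sub_le (exp (-x * I) * (exp (-y * I) - 1)) (exp (x * I) * (exp (y * I) - 1))
  rw [norm_mul, norm_mul, h1, norm_exp_ofReal_mul_I, one_mul, one_mul] at h5
  linarith

theorem norm_cos_sub_one_le {y : ℂ} (hy : ‖y‖ ≤ 1) : ‖cos y - 1‖ ≤ ‖y‖ ^ 2 := by
  have h : cos y - 1 = ((exp (y * I) - 1 - y * I) + (exp (-y * I) - 1 - -y * I)) / 2 := by
    simp only [cos]
    ring
  have h1 := Complex.norm_exp_sub_one_sub_id_le (x := y * I) (by simpa using hy)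
  have h2 := Complex.norm_exp_sub_one_sub_id_le (x := -y * I) (by simpa using hy)
  have h3 := norm_add_le (exp (y * I) - 1 - y * I) (exp (-y * I) - 1 - -y * I)
  simp only [norm_mul, norm_neg, norm_I, mul_one] at h1 h2
  rw [h, norm_div]
  simp only [Complex.norm_ofNat]
  linarith

/-- The secular equation has a solution near the point `θ + i L / N`, where
`L = log (4 sin² θ / h)`. In the local coordinate `t` it is a small perturbation of the equation
`1 = exp (i t)`, and the quantitative open mapping theorem applies on the disc `‖t‖ ≤ 1 / 2`. -/
theorem exists_secular_zero {θ h N : ℝ} (hθ0 : 0 < θ) (hθ1 : θ ≤ 1 / 2) (hh : 0 < h)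
    (hN : 0 < N) (hA : 100 * h ≤ Real.sin θ ^ 2)
    (hB : 400 * (Real.log (4 / h) + 1) ≤ N * Real.sin θ) :
    ∃ t : ℂ, ‖t‖ ≤ 1 / 2 ∧ ∀ ζ e : ℂ,
      ζ = θ + (I * Real.log (4 * Real.sin θ ^ 2 / h) + t) / N →
      e = I * (h / (4 * Real.sin θ ^ 2) : ℝ) * exp (I * t) →
      1 + 2 * e * cos ζ + e ^ 2 = exp (I * t) * (sin ζ / Real.sin θ) ^ 2 := by
  have hsin : 0 < Real.sin θ := Real.sin_pos_of_pos_of_lt_pi hθ0 (by linarith [Real.pi_gt_three])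
  have hsin1 : Real.sin θ ≤ 1 := Real.sin_le_one θ
  set L := Real.log (4 * Real.sin θ ^ 2 / h) with hL
  have hL0 : 0 ≤ L := by
    refine Real.log_nonneg ?_
    rw [le_div_iff₀ hh]
    linarith
  have hL1 : L ≤ Real.log (4 / h) := by
    refine Real.log_le_log (by positivity) ?_
    gcongr
    nlinarith
  set a := h / (4 * Real.sin θ ^ 2) with ha
  have ha0 : 0 ≤ a := by positivity
  have ha1 : a ≤ 1 / 400 := by
    rw [ha, div_le_iff₀ (by positivity)]
    linarith
  let ζ : ℂ → ℂ := fun t => θ + (I * L + t) / N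
  let e : ℂ → ℂ := fun t => I * (a : ℝ) * exp (I * t)
  let f : ℂ → ℂ := fun t => 1 + 2 * e t * cos (ζ t) + e t ^ 2 -
    exp (I * t) * (sin (ζ t) / Real.sin θ) ^ 2
  have hf : Differentiable ℂ f := by
    simp only [f, e, ζ]
    fun_prop
  have hsinC : ((Real.sin θ : ℝ) : ℂ) ≠ 0 := ofReal_ne_zero.2 hsin.ne'
  -- `f` is uniformly close to `1 - exp (i t)`
  have happrox : ∀ t : ℂ, ‖t‖ ≤ 1 / 2 → ‖f t - (1 - exp (I * t))‖ ≤ 6 / 100 := by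
    intro t ht
    have hIt : ‖I * t‖ = ‖t‖ := by simp
    have hexp : ‖exp (I * t)‖ ≤ 2 := by
      have h1 := Complex.norm_exp_sub_one_le (x := I * t) (by rw [hIt]; linarith)
      have h2 := norm_add_le (exp (I * t) - 1) 1
      rw [sub_add_cancel, norm_one] at h2
      linarith
    have he : ‖e t‖ ≤ 1 / 200 := by
      simp only [e, norm_mul, norm_I, one_mul, norm_real, Real.norm_of_nonneg ha0]
      nlinarith [norm_nonneg (exp (I * t))]
    set η : ℂ := (I * L + t) / N with hη
    have hηn : ‖η‖ ≤ Real.sin θ / 400 := by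
      have h1 : ‖I * L + t‖ ≤ Real.log (4 / h) + 1 := by
        calc ‖I * L + t‖ ≤ ‖I * (L : ℂ)‖ + ‖t‖ := norm_add_le _ _
          _ = L + ‖t‖ := by simp [abs_of_nonneg hL0]
          _ ≤ _ := by linarith
      rw [hη, norm_div, norm_real, Real.norm_of_nonneg hN.le, div_le_iff₀ hN]
      linarith
    have hη1 : ‖η‖ ≤ 1 / 400 := hηn.trans (by linarith)
    have hcos : ‖cos (ζ t)‖ ≤ 2 := by
      have h1 : ‖(ζ t)‖ ≤ 1 := by
        calc ‖(θ : ℂ) + η‖ ≤ ‖(θ : ℂ)‖ + ‖η‖ := norm_add_le _ _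
          _ = θ + ‖η‖ := by rw [norm_real, Real.norm_of_nonneg hθ0.le]
          _ ≤ 1 := by linarith
      have h2 := norm_cos_sub_one_le h1
      have h3 := norm_add_le (cos (ζ t) - 1) 1
      rw [sub_add_cancel, norm_one] at h3
      nlinarith [norm_nonneg (ζ t)]
    set ρ : ℂ := sin (ζ t) / Real.sin θ - 1 with hρ
    have hρn : ‖ρ‖ ≤ 1 / 200 := by
      have h1 : ρ = (sin (θ + η) - sin θ) / (Real.sin θ : ℝ) := by
        rw [hρ, sub_div]
        congr 1
        rw [← ofReal_sin, div_self hsinC]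
      rw [h1, norm_div, norm_real, Real.norm_of_nonneg hsin.le, div_le_iff₀ hsin]
      have := norm_sin_add_sub_sin_le θ (y := η) (by linarith)
      linarith
    have hdecomp : f t - (1 - exp (I * t)) =
        2 * e t * cos (ζ t) + e t ^ 2 - exp (I * t) * (ρ * (2 + ρ)) := by
      have : sin (ζ t) / Real.sin θ = 1 + ρ := by rw [hρ]; ring
      simp only [f, this]
      ring
    have hρ2 : ‖2 + ρ‖ ≤ 3 := by
      have := norm_add_le 2 ρ
      simp only [Complex.norm_ofNat] at this
      linarith
    have b1 : ‖2 * e t * cos (ζ t)‖ ≤ 2 / 100 := by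
      rw [norm_mul, norm_mul, Complex.norm_ofNat]
      nlinarith [norm_nonneg (e t), norm_nonneg (cos (ζ t))]
    have b2 : ‖e t ^ 2‖ ≤ 1 / 100 := by
      rw [norm_pow]
      nlinarith [norm_nonneg (e t)]
    have b3 : ‖exp (I * t) * (ρ * (2 + ρ))‖ ≤ 3 / 100 := by
      rw [norm_mul, norm_mul]
      calc ‖exp (I * t)‖ * (‖ρ‖ * ‖2 + ρ‖) ≤ 2 * (1 / 200 * 3) := by gcongr
        _ = 3 / 100 := by norm_num
    rw [hdecomp]
    have h1 := norm_sub_le (2 * e t * cos (ζ t) + e t ^ 2) (exp (I * t) * (ρ * (2 + ρ)))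
    have h2 := norm_add_le (2 * e t * cos (ζ t)) (e t ^ 2)
    linarith
  have hf0 : ‖f 0‖ ≤ 6 / 100 := by
    have := happrox 0 (by simp)
    simpa using this
  have hsphere : ∀ t ∈ sphere (0 : ℂ) (1 / 2), 13 / 100 ≤ ‖f t - f 0‖ := by
    intro t ht
    rw [mem_sphere_zero_iff_norm] at ht
    have h1 := happrox t ht.le
    have hIt : ‖I * t‖ = 1 / 2 := by simpa using ht
    have h2 := Complex.norm_exp_sub_one_sub_id_le (x := I * t) (by rw [hIt]; norm_num)
    rw [hIt] at h2
    have h3 : I * t = (f t - f 0) * (-1) + (f t - (1 - exp (I * t))) - f 0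
        - (exp (I * t) - 1 - I * t) := by ring
    have h4 := norm_sub_le ((f t - f 0) * (-1) + (f t - (1 - exp (I * t))) - f 0)
      (exp (I * t) - 1 - I * t)
    have h5 := norm_sub_le ((f t - f 0) * (-1) + (f t - (1 - exp (I * t)))) (f 0)
    have h6 := norm_add_le ((f t - f 0) * (-1)) (f t - (1 - exp (I * t)))
    rw [← h3, hIt] at h4
    rw [norm_mul, norm_neg, norm_one, mul_one] at h6
    -- `1 / 2 ≤ ‖f t - f 0‖ + 6 / 100 + 6 / 100 + 1 / 4`
    linarith
  have hfreq : ∃ᶠ t in nhds (0 : ℂ), f t ≠ f 0 := by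
    by_contra hcon
    rw [Filter.not_frequently] at hcon
    have hev : f =ᶠ[nhds 0] fun _ => f 0 := by
      filter_upwards [hcon] with t ht using not_not.1 ht
    have han : AnalyticOnNhd ℂ f Set.univ := fun t _ => hf.analyticAt t
    have heq := han.eq_of_eventuallyEq (fun _ _ => analyticAt_const) hev
    have hmem : ((1 / 2 : ℝ) : ℂ) ∈ sphere (0 : ℂ) (1 / 2) := by
      simp
    have := hsphere _ hmem
    rw [congrFun heq, sub_self, norm_zero] at this
    norm_num at this
  have himage := (hf.diffContOnCl (s := ball 0 (1 / 2))).ball_subset_image_closedBall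
    (by norm_num) hsphere hfreq
  obtain ⟨t, ht, hft⟩ : (0 : ℂ) ∈ f '' closedBall 0 (1 / 2) := himage (by
    rw [mem_ball, dist_comm, dist_zero_right]
    linarith)
  refine ⟨t, by simpa using ht, ?_⟩
  rintro _ _ rfl rfl
  exact sub_eq_zero.1 hft

end Jacobi

/-! ### Eigenvalues of the Schrödinger operator with a constant imaginary potential -/

namespace Jacobi

open Complex Metric

theorem sinh_le_two_mul {y : ℝ} (h0 : 0 ≤ y) (h1 : y ≤ 1) : Real.sinh y ≤ 2 * y := by
  have h2 := Real.abs_exp_sub_one_le (x := y) (by rwa [abs_of_nonneg h0])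
  have h3 := Real.abs_exp_sub_one_le (x := -y) (by rwa [abs_neg, abs_of_nonneg h0])
  rw [abs_neg, abs_of_nonneg h0] at h3
  rw [abs_of_nonneg h0] at h2
  rw [Real.sinh_eq]
  linarith [(abs_le.1 h2).2, (abs_le.1 h3).1]

theorem cos_im_eq (z : ℂ) : (cos z).im = -(Real.sin z.re * Real.sinh z.im) := by
  conv_lhs => rw [← re_add_im z]
  rw [cos_add_mul_I, ← ofReal_cos, ← ofReal_sin, ← ofReal_cosh, ← ofReal_sinh, sub_im,
    ← ofReal_mul, ofReal_im, ← ofReal_mul, mul_I_im, ofReal_re, zero_sub]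

/-- The unperturbed positions `π (2 j + 1) / (2 n)` of the solutions of the secular equation. -/
noncomputable def gridAngle (n j : ℕ) : ℝ := Real.pi * (2 * j + 1) / (2 * n)

set_option maxHeartbeats 800000 in
/-- For every grid angle `θ` between a multiple of `√h` and `1 / 2` there is a discrete eigenvalue
`2 cos ζ + i h` with `ζ` close to `θ`; its distance to `[-2, 2]` is at least its imaginary part,
hence at least `h / 2`. -/
theorem exists_eigenvalue_near_gridAngle {n : ℕ} (hn : 1 ≤ n) {h : ℝ} (hh : 0 < h)
    (hbig : 400 * (Real.log (4 / h) + 1) ≤ n * h) {b : BddSeq}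
    (hb : ∀ k : ℤ, b k = if 1 ≤ k ∧ k ≤ n then I * (h : ℂ) else 0) {j : ℕ}
    (hθh : 400 * h ≤ gridAngle n j ^ 2) (hθ1 : gridAngle n j ≤ 1 / 2) :
    ∃ ζ : ℂ, |ζ.re - gridAngle n j| ≤ 1 / (2 * n) ∧ ζ.re ∈ Set.Ioo (0 : ℝ) 1 ∧ 0 < ζ.im ∧
      2 * cos ζ + I * h ∈ discreteSpectrum (jacobiOp 1 b 1) ∧
      1 ≤ algMultiplicity (jacobiOp 1 b 1) (2 * cos ζ + I * h) ∧
      h / 2 ≤ (2 * cos ζ + I * h).im ∧ ‖2 * cos ζ + I * h - 2‖ ≤ 9 * gridAngle n j ^ 2 := by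
  have hnR : (1 : ℝ) ≤ n := by exact_mod_cast hn
  have hn0 : (0 : ℝ) < n := by linarith
  have hnC : (n : ℂ) ≠ 0 := by exact_mod_cast hn0.ne'
  set θ := gridAngle n j with hθ
  have hθn : 1 / n ≤ θ := by
    rw [hθ, gridAngle, div_le_div_iff₀ hn0 (by positivity)]
    have : (0 : ℝ) ≤ j := j.cast_nonneg
    nlinarith [Real.pi_gt_three, mul_nonneg Real.pi_pos.le this]
  have hθ0 : 0 < θ := lt_of_lt_of_le (by positivity) hθn
  have hhθ : 800 * h ≤ θ := by nlinarith
  have hsinθ : θ / 2 ≤ Real.sin θ := by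
    have := Real.sin_gt_sub_cube hθ0
    nlinarith [sq_nonneg θ, mul_pos hθ0 hθ0]
  have hsin0 : 0 < Real.sin θ := by linarith
  have hA : 100 * h ≤ Real.sin θ ^ 2 := by nlinarith
  have hB : 400 * (Real.log (4 / h) + 1) ≤ n * Real.sin θ :=
    hbig.trans (by gcongr; linarith)
  obtain ⟨t, ht, hsol⟩ := exists_secular_zero hθ0 hθ1 hh hn0 hA hB
  set L := Real.log (4 * Real.sin θ ^ 2 / h) with hL
  set a := h / (4 * Real.sin θ ^ 2) with ha
  have ha0 : 0 < a := by positivity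
  have ha1 : a ≤ 1 / 400 := by
    rw [ha, div_le_iff₀ (by positivity)]
    linarith
  have hainv : (4 * Real.sin θ ^ 2 / h)⁻¹ = a := inv_div _ _
  have hL0 : 1 - 1 / 400 ≤ L := by
    have := Real.one_sub_inv_le_log_of_pos (x := 4 * Real.sin θ ^ 2 / h) (by positivity)
    rw [hainv] at this
    linarith
  have hL1 : L ≤ Real.log (4 / h) := by
    refine Real.log_le_log (by positivity) ?_
    gcongr
    nlinarith [Real.sin_le_one θ]
  have hexpL : Real.exp (-L) = a := by
    rw [Real.exp_neg, Real.exp_log (by positivity), hainv]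
  set ζ : ℂ := θ + (I * L + t) / (n : ℝ) with hζ
  have htre := (abs_re_le_norm t).trans ht
  have htim := (abs_im_le_norm t).trans ht
  have hre : ζ.re = θ + t.re / n := by
    rw [hζ, add_re, div_ofReal_re]
    simp
  have him : ζ.im = (L + t.im) / n := by
    rw [hζ, add_im, div_ofReal_im]
    simp
  have hreθ : |ζ.re - θ| ≤ 1 / (2 * n) := by
    rw [hre, add_sub_cancel_left, abs_div, abs_of_pos hn0, div_le_div_iff₀ hn0 (by positivity)]
    nlinarith
  have hreθ2 : |ζ.re - θ| ≤ θ / 2 := hreθ.trans (by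
    have : 1 / (2 * (n : ℝ)) = 1 / n / 2 := by field_simp
    rw [this]
    linarith)
  have him0 : 0 < ζ.im := by
    rw [him]
    exact div_pos (by linarith [(abs_le.1 htim).1]) hn0
  have him1 : ζ.im ≤ h / 400 := by
    rw [him, div_le_iff₀ hn0]
    linarith [(abs_le.1 htim).2]
  have hre0 : 0 < ζ.re := by linarith [(abs_le.1 hreθ2).1]
  have hre1 : ζ.re ≤ 3 / 2 * θ := by linarith [(abs_le.1 hreθ2).2]
  set w := exp (I * ζ) with hw
  set e := I * (a : ℝ) * exp (I * t) with he
  have hsolv := hsol ζ e rfl rfl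
  have hwinv : w⁻¹ = exp (-(I * ζ)) := (exp_neg _).symm
  have hww : w + w⁻¹ = 2 * cos ζ := by
    rw [hwinv, hw, cos]
    ring_nf
  have hww' : w - w⁻¹ = 2 * I * sin ζ := by
    rw [hwinv, hw, sin, mul_comm I ζ, ← neg_mul]
    linear_combination (exp (ζ * I) - exp (-ζ * I)) * I_sq
  have hw1 : ‖w‖ < 1 := by
    rw [hw, norm_exp, Real.exp_lt_one_iff]
    simpa using him0
  have hwim : 0 < w.im := by
    rw [hw, exp_im]
    refine mul_pos (Real.exp_pos _) ?_
    simp only [mul_im, I_re, I_im, zero_mul, one_mul, zero_add]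
    exact Real.sin_pos_of_pos_of_lt_pi hre0 (by linarith [Real.pi_gt_three])
  have he1 : ‖e‖ < 1 := by
    have h1 := Complex.norm_exp_sub_one_le (x := I * t) (by simp; linarith)
    have h2 := norm_add_le (exp (I * t) - 1) 1
    rw [sub_add_cancel, norm_one] at h2
    have h3 : ‖I * t‖ ≤ 1 / 2 := by simpa using ht
    rw [he, norm_mul, norm_mul, norm_I, one_mul, norm_real, Real.norm_of_nonneg ha0.le]
    nlinarith [norm_nonneg (exp (I * t))]
  have heim : 0 < e.im := by
    have h1 : e.im = a * (exp (I * t)).re := by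
      rw [he, mul_assoc, I_mul_im, re_ofReal_mul]
    rw [h1, exp_re]
    refine mul_pos ha0 (mul_pos (Real.exp_pos _) (Real.cos_pos_of_mem_Ioo ?_))
    simp only [mul_im, I_re, I_im, zero_mul, one_mul, zero_add]
    constructor <;> linarith [(abs_le.1 htre).1, (abs_le.1 htre).2, Real.pi_gt_three]
  have hs : ((-1 : ℂ) ^ j) * (-1) ^ j = 1 := by
    rw [← mul_pow]; simp
  -- `exp (i n θ) = (-1) ^ j i`, by the choice of the grid, and `exp (-L) = a`
  have hew : e = (-1) ^ j * w ^ n := by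
    have h1 : w ^ n = exp (j * (Real.pi * I) + Real.pi / 2 * I + (-L : ℝ) + I * t) := by
      rw [hw, ← exp_nat_mul]
      congr 1
      rw [hζ, hθ, gridAngle]
      push_cast
      field_simp
      linear_combination (2 * (L : ℂ)) * I_sq
    rw [h1, exp_add, exp_add, exp_add, exp_nat_mul, exp_pi_mul_I, exp_pi_div_two_mul_I,
      ← ofReal_exp, hexpL, he]
    linear_combination (-(I * a * exp (I * t))) * hs
  have hsec : e * (w - w⁻¹) ^ 2 = -(I * h) * ((1 + e * w) * (1 + e * w⁻¹)) := by
    have hw0 : w ≠ 0 := exp_ne_zero _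
    have h1 : (1 + e * w) * (1 + e * w⁻¹) = exp (I * t) * (sin ζ / Real.sin θ) ^ 2 := by
      rw [← hsolv]
      have : w * w⁻¹ = 1 := mul_inv_cancel₀ hw0
      linear_combination e * hww + e ^ 2 * this
    have hsinC : ((Real.sin θ : ℝ) : ℂ) ≠ 0 := ofReal_ne_zero.2 hsin0.ne'
    rw [h1, hww', he, ha]
    push_cast
    rw [← ofReal_sin] at *
    field_simp
    linear_combination (4 * h * sin ζ ^ 2) * I_sq
  have hIm : h / 2 ≤ (2 * cos ζ + I * h).im := by
    have h1 : (2 * cos ζ + I * h).im = h - 2 * (Real.sin ζ.re * Real.sinh ζ.im) := by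
      rw [add_im, mul_im, cos_im_eq]
      simp
      ring
    have h2 := sinh_le_two_mul him0.le (by linarith)
    have h3 : 0 ≤ Real.sinh ζ.im := Real.sinh_nonneg_iff.2 him0.le
    have h4 : Real.sin ζ.re * Real.sinh ζ.im ≤ 1 * Real.sinh ζ.im := by
      gcongr
      exact Real.sin_le_one _
    rw [h1]
    linarith
  have hζn : ‖ζ‖ ≤ 8 / 5 * θ := by
    have h1 := norm_le_abs_re_add_abs_im ζ
    rw [abs_of_pos hre0, abs_of_pos him0] at h1
    linarith
  have hmem := mem_discreteSpectrum_of_secular hn hb hw1 he1 hwim heim hs hew hsec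
    (by rw [hww]; linarith)
  rw [hww] at hmem
  refine ⟨ζ, hreθ, ⟨hre0, by linarith⟩, him0, hmem.1, hmem.2, hIm, ?_⟩
  have h1 := norm_cos_sub_one_le (y := ζ) (by linarith)
  have h2 : 2 * cos ζ + I * h - 2 = 2 * (cos ζ - 1) + I * h := by ring
  have h3 := norm_add_le (2 * (cos ζ - 1)) (I * (h : ℂ))
  rw [norm_mul, norm_mul, norm_I, one_mul, norm_real, Real.norm_of_nonneg hh.le,
    Complex.norm_ofNat] at h3
  rw [h2]
  nlinarith [norm_nonneg ζ]

end Jacobi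

/-! ### Lower bounds for the weighted eigenvalue sum -/

namespace Jacobi

open Metric Set MeasureTheory

theorem freeSpectrum_nonempty : freeSpectrum.Nonempty := ⟨_, 0, by norm_num, rfl⟩

theorem im_le_infDist_freeSpectrum (lam : ℂ) : lam.im ≤ infDist lam freeSpectrum := by
  refine (le_infDist freeSpectrum_nonempty).2 ?_
  rintro _ ⟨x, -, rfl⟩
  have := Complex.abs_im_le_norm (lam - x)
  rw [Complex.sub_im, Complex.ofReal_im, sub_zero] at this
  exact (le_abs_self _).trans (this.trans_eq (dist_eq_norm _ _).symm)

/-- A lower bound for the summand at an eigenvalue `lam` near `2`, of distance at least `h / 2` from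
`[-2, 2]` and at most of order `θ ^ 2` from `2`. -/
theorem le_eigenvalueWeight {p : ℝ} (hp : 0 ≤ p) {f : ℝ → ℝ} (hf : IsNonintegrableWeight f)
    {h θ : ℝ} (hh : 0 < h) (hθ0 : 0 < θ) (hθ1 : θ ≤ 1 / 2) {lam : ℂ} (him : h / 2 ≤ lam.im)
    (hnorm : ‖lam - 2‖ ≤ 9 * θ ^ 2) :
    (h / 2) ^ p / 9 * (f (Real.log (18 * θ ^ 2 / h)) / θ) ≤ eigenvalueWeight p f lam := by
  set d := infDist lam freeSpectrum
  set d2 := infDist lam ({-2, 2} : Set ℂ)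
  have hd : h / 2 ≤ d := him.trans (im_le_infDist_freeSpectrum lam)
  have hd0 : 0 < d := by linarith
  have hd2 : d2 ≤ 9 * θ ^ 2 := by
    have : d2 ≤ dist lam 2 := infDist_le_dist_of_mem (by simp)
    rw [dist_eq_norm] at this
    exact this.trans hnorm
  have hdd : d ≤ d2 := by
    refine infDist_le_infDist_of_subset ?_ (by simp)
    rintro z (rfl | rfl)
    · exact ⟨-2, by norm_num, by norm_num⟩
    · exact ⟨2, by norm_num, by norm_num⟩
  have hd20 : 0 < d2 := hd0.trans_le hdd
  have harg : -Real.log (d / d2) = Real.log (d2 / d) := by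
    rw [← Real.log_inv, inv_div]
  have harg0 : 0 ≤ Real.log (d2 / d) := Real.log_nonneg ((one_le_div hd0).2 hdd)
  have harg1 : Real.log (d2 / d) ≤ Real.log (18 * θ ^ 2 / h) := by
    refine Real.log_le_log (by positivity) ?_
    rw [div_le_div_iff₀ hd0 hh]
    nlinarith [sq_nonneg θ]
  have hfle : f (Real.log (18 * θ ^ 2 / h)) ≤ f (Real.log (d2 / d)) :=
    hf.antitoneOn harg0 (harg0.trans harg1) harg1
  have hf0 : 0 < f (Real.log (18 * θ ^ 2 / h)) := hf.pos _ (harg0.trans harg1)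
  have hsq : ‖lam ^ 2 - 4‖ ≤ (9 * θ) ^ 2 := by
    have h1 : lam ^ 2 - 4 = (lam - 2) * ((lam - 2) + 4) := by ring
    have h2 : ‖(lam - 2) + 4‖ ≤ ‖lam - 2‖ + 4 := by
      simpa using norm_add_le (lam - 2) 4
    rw [h1, norm_mul]
    have h3 : ‖(lam - 2) + 4‖ ≤ 9 := by nlinarith
    calc ‖lam - 2‖ * ‖(lam - 2) + 4‖ ≤ 9 * θ ^ 2 * 9 := by gcongr
      _ = (9 * θ) ^ 2 := by ring
  have hsq0 : 0 < ‖lam ^ 2 - 4‖ := by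
    rw [norm_pos_iff]
    intro h0
    have h1 : (lam - 2) * (lam + 2) = 0 := by linear_combination h0
    have him0 : 0 < lam.im := by linarith
    rcases mul_eq_zero.1 h1 with h2 | h2
    · rw [sub_eq_zero.1 h2] at him0; simp at him0
    · rw [eq_neg_of_add_eq_zero_left h2] at him0; simp at him0
  have hroot : ‖lam ^ 2 - 4‖ ^ (1 / 2 : ℝ) ≤ 9 * θ := by
    rw [← Real.sqrt_eq_rpow, Real.sqrt_le_left (by positivity)]
    exact hsq
  have hroot0 : 0 < ‖lam ^ 2 - 4‖ ^ (1 / 2 : ℝ) := Real.rpow_pos_of_pos hsq0 _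
  have hrp : (h / 2) ^ p ≤ d ^ p := Real.rpow_le_rpow (by positivity) hd hp
  calc (h / 2) ^ p / 9 * (f (Real.log (18 * θ ^ 2 / h)) / θ)
      = (h / 2) ^ p / (9 * θ) * f (Real.log (18 * θ ^ 2 / h)) := by field_simp
    _ ≤ d ^ p / ‖lam ^ 2 - 4‖ ^ (1 / 2 : ℝ) * f (Real.log (d2 / d)) := by gcongr
    _ = eigenvalueWeight p f lam := by rw [← harg]; rfl

theorem IsNonintegrableWeight.intervalIntegrable {f : ℝ → ℝ} (hf : IsNonintegrableWeight f)
    {x y : ℝ} (hx : 0 ≤ x) (hy : 0 ≤ y) : IntervalIntegrable f volume x y := by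
  refine (hf.continuousOn.mono ?_).intervalIntegrable
  intro t ht
  exact (le_min hx hy).trans ht.1

theorem IsNonintegrableWeight.integral_le {f : ℝ → ℝ} (hf : IsNonintegrableWeight f)
    {x y : ℝ} (hx : 0 ≤ x) (hxy : x ≤ y) : ∫ t in x..y, f t ≤ f x * (y - x) := by
  have h := intervalIntegral.integral_mono_on hxy (hf.intervalIntegrable hx (hx.trans hxy))
    (intervalIntegrable_const (c := f x)) fun t ht => hf.antitoneOn hx (hx.trans ht.1) ht.1
  rw [intervalIntegral.integral_const, smul_eq_mul, mul_comm] at h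
  exact h

theorem gridAngle_pos {n : ℕ} (hn : 1 ≤ n) (j : ℕ) : 0 < gridAngle n j := by
  have : (1 : ℝ) ≤ n := by exact_mod_cast hn
  unfold gridAngle
  positivity

theorem gridAngle_mono (n : ℕ) : Monotone (gridAngle n) := by
  intro i j hij
  unfold gridAngle
  gcongr

theorem gridAngle_succ_sub {n : ℕ} (hn : 1 ≤ n) (j : ℕ) :
    gridAngle n (j + 1) - gridAngle n j = Real.pi / n := by
  have : (n : ℝ) ≠ 0 := by exact_mod_cast (show n ≠ 0 by omega)
  unfold gridAngle
  push_cast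
  field_simp
  ring

/-- The sum over the grid angles dominates an integral, since the logarithmic increments
`log θ_{j+1} - log θ_j` are at most `π / (n θ_j)`. -/
theorem integral_le_sum_gridAngle {f : ℝ → ℝ} (hf : IsNonintegrableWeight f) {n : ℕ} (hn : 1 ≤ n)
    {h : ℝ} (hh : 0 < h) {a b : ℕ} (hab : a ≤ b) (ha : h ≤ 18 * gridAngle n a ^ 2) :
    ∫ t in Real.log (18 * gridAngle n a ^ 2 / h)..Real.log (18 * gridAngle n b ^ 2 / h), f t ≤
      2 * Real.pi / n *
        ∑ j ∈ Finset.Ico a b, f (Real.log (18 * gridAngle n j ^ 2 / h)) / gridAngle n j := by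
  have hn0 : (0 : ℝ) < n := by exact_mod_cast hn
  set X : ℕ → ℝ := fun j => Real.log (18 * gridAngle n j ^ 2 / h) with hX
  have hX0 : ∀ j, a ≤ j → 0 ≤ X j := by
    intro j hj
    refine Real.log_nonneg ((one_le_div hh).2 (ha.trans ?_))
    have := gridAngle_pos hn a
    gcongr
    exact gridAngle_mono n hj
  have hsum := intervalIntegral.sum_integral_adjacent_intervals_Ico (f := f) (μ := volume) (a := X)
    hab fun k hk => hf.intervalIntegrable (hX0 k hk.1) (hX0 (k + 1) (by have := hk.1; omega))
  change ∫ t in X a..X b, f t ≤ _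
  rw [← hsum, Finset.mul_sum]
  refine Finset.sum_le_sum fun j hj => ?_
  have hj' := (Finset.mem_Ico.1 hj).1
  have hθ := gridAngle_pos hn j
  have hθ' := gridAngle_pos hn (j + 1)
  have hdiff : X (j + 1) - X j = 2 * Real.log (gridAngle n (j + 1) / gridAngle n j) := by
    simp only [hX]
    rw [← Real.log_div (by positivity) (by positivity)]
    have : 18 * gridAngle n (j + 1) ^ 2 / h / (18 * gridAngle n j ^ 2 / h) =
        (gridAngle n (j + 1) / gridAngle n j) ^ 2 := by
      field_simp
    rw [this, Real.log_pow]
    norm_num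
  have hlog : Real.log (gridAngle n (j + 1) / gridAngle n j) ≤ Real.pi / n / gridAngle n j := by
    refine (Real.log_le_sub_one_of_pos (by positivity)).trans (le_of_eq ?_)
    rw [← gridAngle_succ_sub hn j]
    field_simp
  have hmono : X j ≤ X (j + 1) := by
    refine Real.log_le_log (by positivity) ?_
    gcongr
    exact gridAngle_mono n (Nat.le_succ j)
  calc ∫ t in X j..X (j + 1), f t ≤ f (X j) * (X (j + 1) - X j) :=
        hf.integral_le (hX0 j hj') hmono
    _ ≤ f (X j) * (2 * (Real.pi / n / gridAngle n j)) := by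
        rw [hdiff]
        have := (hf.pos _ (hX0 j hj')).le
        gcongr
    _ = 2 * Real.pi / n * (f (X j) / gridAngle n j) := by ring

/-- The parameters `ζ` can be recovered from the eigenvalues `2 cos ζ + i h`. -/
theorem cos_injOn_strip {z w : ℂ} (hz : z.re ∈ Ioo (0 : ℝ) 1) (hw : w.re ∈ Ioo (0 : ℝ) 1)
    (hzi : 0 < z.im) (hwi : 0 < w.im) (h : Complex.cos z = Complex.cos w) : z = w := by
  rw [Complex.cos_eq_cos_iff] at h
  obtain ⟨k, hk | hk⟩ := h
  · have hre := congrArg Complex.re hk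
    have e : (2 * (k : ℂ) * Real.pi + z).re = 2 * k * Real.pi + z.re := by
      simp
    rw [e] at hre
    have hk0 : k = 0 := by
      have h1 : |(k : ℝ)| < 1 := by
        rw [abs_lt]
        constructor <;> nlinarith [Real.pi_gt_three, hz.1, hz.2, hw.1, hw.2]
      have h2 : |k| < 1 := by exact_mod_cast h1
      exact Int.abs_lt_one_iff.1 h2
    rw [hk, hk0]
    simp
  · have him := congrArg Complex.im hk
    have e : (2 * (k : ℂ) * Real.pi - z).im = -z.im := by
      simp
    rw [e] at him
    linarith

end Jacobi

/-! ### The ratio for large `n` -/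

namespace Jacobi

open Metric Set MeasureTheory Filter

theorem deviation_potential (n : ℕ) (k : ℤ) :
    deviation 1 (potential n) 1 k = if 1 ≤ k ∧ k ≤ n then (n : ℝ) ^ (-2 / 3 : ℝ) else 0 := by
  have h0 : (0 : ℝ) ≤ (n : ℝ) ^ (-2 / 3 : ℝ) := by positivity
  have h1 : potential n k = potentialFun n k := rfl
  simp only [deviation, coe_one_bddSeq, h1, potentialFun, sub_self, norm_zero]
  split_ifs
  · rw [norm_mul, Complex.norm_I, one_mul, Complex.norm_real, Real.norm_of_nonneg h0]
    simp [h0]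
  · simp

theorem normPow_potential {p : ℝ} (hp : 0 < p) (n : ℕ) :
    normPow p (deviation 1 (potential n) 1) =
      ENNReal.ofReal (n * ((n : ℝ) ^ (-2 / 3 : ℝ)) ^ p) := by
  have h0 : (0 : ℝ) ≤ (n : ℝ) ^ (-2 / 3 : ℝ) := by positivity
  rw [normPow, tsum_eq_sum (s := Finset.Icc 1 (n : ℤ))]
  · rw [Finset.sum_congr rfl (g := fun _ => ENNReal.ofReal (((n : ℝ) ^ (-2 / 3 : ℝ)) ^ p))]
    · rw [Finset.sum_const, Int.card_Icc, nsmul_eq_mul, ENNReal.ofReal_mul (by positivity)]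
      simp
    · intro k hk
      rw [deviation_potential, if_pos (Finset.mem_Icc.1 hk), abs_of_nonneg h0]
  · intro k hk
    rw [deviation_potential, if_neg (fun h => hk (Finset.mem_Icc.2 h)), abs_zero,
      Real.zero_rpow hp.ne', ENNReal.ofReal_zero]

theorem ratio_le_supRatio (p : ℝ) (m : (L2Z →L[ℂ] L2Z) → ℂ → ℕ) (f : ℝ → ℝ) {n : ℕ}
    (hn : 1 ≤ n) : ratio m p f 1 (potential n) 1 ≤ supRatio m p f := by
  have hne : deviation 1 (potential n) 1 ≠ 0 := by
    intro h
    have h1 := congrFun h 1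
    rw [deviation_potential, if_pos ⟨le_rfl, by exact_mod_cast hn⟩] at h1
    have : (0 : ℝ) < (n : ℝ) ^ (-2 / 3 : ℝ) :=
      Real.rpow_pos_of_pos (by exact_mod_cast hn) _
    exact this.ne' h1
  have hmem : Memℓp (deviation 1 (potential n) 1) (ENNReal.ofReal p) := by
    have hfin : (Function.support (deviation 1 (potential n) 1)).Finite := by
      refine (Set.finite_Icc (1 : ℤ) n).subset fun k hk => ?_
      by_contra h
      exact hk ((deviation_potential n k).trans (if_neg h))
    exact (memℓp_zero hfin).of_exponent_ge zero_le
  exact le_iSup_of_le 1 (le_iSup_of_le (potential n) (le_iSup_of_le 1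
    (le_iSup_of_le hne (le_iSup_of_le hmem le_rfl))))

theorem one_le_of_mem_countings {m : (L2Z →L[ℂ] L2Z) → ℂ → ℕ} (hm : m ∈ countings)
    {T : L2Z →L[ℂ] L2Z} {lam : ℂ} (h : 1 ≤ algMultiplicity T lam) : 1 ≤ m T lam := by
  rcases hm with rfl | rfl
  · exact le_rfl
  · exact h

/-- A point is close to at most one grid angle. -/
theorem eq_of_abs_sub_gridAngle_le {n : ℕ} (hn : 1 ≤ n) {i j : ℕ} {x : ℝ}
    (hi : |x - gridAngle n i| ≤ 1 / (2 * n)) (hj : |x - gridAngle n j| ≤ 1 / (2 * n)) :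
    i = j := by
  have hn0 : (0 : ℝ) < n := by exact_mod_cast hn
  have key : ∀ {i j : ℕ}, |x - gridAngle n i| ≤ 1 / (2 * n) →
      |x - gridAngle n j| ≤ 1 / (2 * n) → ¬ i < j := by
    intro i j hi hj hij
    have h1 := gridAngle_mono n (Nat.succ_le_of_lt hij)
    have h2 := gridAngle_succ_sub hn i
    have h3 : (1 : ℝ) / n < Real.pi / n := by
      gcongr
      linarith [Real.pi_gt_three]
    have h4 : 1 / (2 * (n : ℝ)) + 1 / (2 * n) = 1 / n := by field_simp; norm_num
    have h5 := (abs_le.1 hi).2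
    have h6 := (abs_le.1 hj).1
    rw [Nat.succ_eq_add_one] at h1
    linarith
  rcases lt_trichotomy i j with h | h | h
  · exact absurd h (key hi hj)
  · exact h
  · exact absurd h (key hj hi)

/-- The eigenvalues near the grid angles contribute at least a sum over these angles. -/
theorem sum_gridAngle_le_eigenvalueSum {p : ℝ} (hp : 0 ≤ p) {f : ℝ → ℝ}
    (hf : IsNonintegrableWeight f) {m : (L2Z →L[ℂ] L2Z) → ℂ → ℕ} (hm : m ∈ countings)
    {n : ℕ} (hn : 1 ≤ n) {h : ℝ} (hh : 0 < h)
    (hbig : 400 * (Real.log (4 / h) + 1) ≤ n * h) {v : BddSeq}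
    (hv : ∀ k : ℤ, v k = if 1 ≤ k ∧ k ≤ n then Complex.I * (h : ℂ) else 0) {a b : ℕ}
    (ha : 400 * h ≤ gridAngle n a ^ 2) (hb : ∀ j < b, gridAngle n j ≤ 1 / 2) :
    ENNReal.ofReal ((h / 2) ^ p / 9 *
        ∑ j ∈ Finset.Ico a b, f (Real.log (18 * gridAngle n j ^ 2 / h)) / gridAngle n j) ≤
      eigenvalueSum m p f (jacobiOp 1 v 1) := by
  have hex : ∀ j : Finset.Ico a b, ∃ ζ : ℂ, |ζ.re - gridAngle n j| ≤ 1 / (2 * n) ∧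
      ζ.re ∈ Set.Ioo (0 : ℝ) 1 ∧ 0 < ζ.im ∧
      2 * Complex.cos ζ + Complex.I * h ∈ discreteSpectrum (jacobiOp 1 v 1) ∧
      1 ≤ algMultiplicity (jacobiOp 1 v 1) (2 * Complex.cos ζ + Complex.I * h) ∧
      h / 2 ≤ (2 * Complex.cos ζ + Complex.I * h).im ∧
      ‖2 * Complex.cos ζ + Complex.I * h - 2‖ ≤ 9 * gridAngle n j ^ 2 := by
    rintro ⟨j, hj⟩
    obtain ⟨haj, hjb⟩ := Finset.mem_Ico.1 hj
    refine exists_eigenvalue_near_gridAngle hn hh hbig hv (ha.trans ?_) (hb j hjb)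
    have := gridAngle_pos hn a
    gcongr
    exact gridAngle_mono n haj
  choose ζ h1 h2 h3 h4 h5 h6 h7 using hex
  let lam : Finset.Ico a b → discreteSpectrum (jacobiOp 1 v 1) := fun j => ⟨_, h4 j⟩
  have hinj : Function.Injective lam := by
    intro i j hij
    have hij' := congrArg Subtype.val hij
    have hcos : Complex.cos (ζ i) = Complex.cos (ζ j) := by
      have : 2 * Complex.cos (ζ i) + Complex.I * h = 2 * Complex.cos (ζ j) + Complex.I * h := hij'
      linear_combination this / 2
    have hζ := cos_injOn_strip (h2 i) (h2 j) (h3 i) (h3 j) hcos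
    exact Subtype.ext (eq_of_abs_sub_gridAngle_le hn (hζ ▸ h1 i) (h1 j))
  refine le_trans ?_ (ENNReal.tsum_comp_le_tsum_of_injective hinj _)
  rw [tsum_fintype, Finset.mul_sum, ← Finset.sum_coe_sort (Finset.Ico a b)]
  have hnonneg : ∀ j : Finset.Ico a b, 0 ≤ (h / 2) ^ p / 9 *
      (f (Real.log (18 * gridAngle n j ^ 2 / h)) / gridAngle n j) := by
    intro j
    have hpos := gridAngle_pos hn (j : ℕ)
    have haj := gridAngle_mono n (Finset.mem_Ico.1 j.2).1
    have hlog : 0 ≤ Real.log (18 * gridAngle n j ^ 2 / h) := by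
      refine Real.log_nonneg ((one_le_div hh).2 ?_)
      have h8 : gridAngle n a ^ 2 ≤ gridAngle n j ^ 2 := by
        have := gridAngle_pos hn a
        gcongr
      linarith
    have := (hf.pos _ hlog).le
    positivity
  rw [ENNReal.ofReal_sum_of_nonneg fun j _ => hnonneg j]
  refine Finset.sum_le_sum fun j _ => ?_
  have hmj : (1 : ℝ≥0∞) ≤ (m (jacobiOp 1 v 1) (lam j) : ℝ≥0∞) := by
    exact_mod_cast one_le_of_mem_countings hm (h5 j)
  calc ENNReal.ofReal ((h / 2) ^ p / 9 *
        (f (Real.log (18 * gridAngle n j ^ 2 / h)) / gridAngle n j))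
      ≤ ENNReal.ofReal (eigenvalueWeight p f (lam j)) :=
        ENNReal.ofReal_le_ofReal (le_eigenvalueWeight hp hf hh (gridAngle_pos hn j)
          (hb j (Finset.mem_Ico.1 j.2).2) (h6 j) (h7 j))
    _ = 1 * ENNReal.ofReal (eigenvalueWeight p f (lam j)) := (one_mul _).symm
    _ ≤ _ := by gcongr

/-- The lower bound for the ratio, for all `n` such that `q = n ^ (1 / 3)` dominates its own
logarithm. -/
theorem ofReal_le_ratio_potential {p : ℝ} (hp : 1 ≤ p) {f : ℝ → ℝ} (hf : IsNonintegrableWeight f)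
    {m : (L2Z →L[ℂ] L2Z) → ℂ → ℕ} (hm : m ∈ countings) {n : ℕ} {q : ℝ} (hq1 : 1 ≤ q)
    (hqn : q ^ 3 = n) (hbig : 400 * (Real.log (4 * q ^ 2) + 1) ≤ q) :
    ENNReal.ofReal ((1 / 2) ^ p / (18 * Real.pi) *
        ((∫ x in (0 : ℝ)..Real.log ((n : ℝ) ^ (2 / 3 : ℝ)), f x) - f 0 * Real.log 7938)) ≤
      ratio m p f 1 (potential n) 1 := by
  have hq0 : 0 < q := by linarith
  have hn1 : (1 : ℝ) ≤ n := hqn ▸ one_le_pow₀ hq1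
  have hn : 1 ≤ n := by exact_mod_cast hn1
  have hn0 : (0 : ℝ) < n := by linarith
  have hpow : (n : ℝ) ^ (2 / 3 : ℝ) = q ^ 2 := by
    rw [← hqn, ← Real.rpow_natCast q 3, ← Real.rpow_mul hq0.le, ← Real.rpow_natCast q 2]
    norm_num
  set h : ℝ := (n : ℝ) ^ (-2 / 3 : ℝ) with hhdef
  have hh : h = (q ^ 2)⁻¹ := by
    rw [hhdef, neg_div, Real.rpow_neg hn0.le, hpow]
  have hh0 : 0 < h := by rw [hh]; positivity
  have hhq : h * q ^ 2 = 1 := by rw [hh]; field_simp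
  have hnh : n * h = q := by
    rw [← hqn, hh]; field_simp
  have hbig' : 400 * (Real.log (4 / h) + 1) ≤ n * h := by
    rw [hnh, hh, div_inv_eq_mul]
    exact hbig
  have hq400 : 400 ≤ q := by
    have : 0 ≤ Real.log (4 * q ^ 2) := Real.log_nonneg (by nlinarith)
    linarith
  have hpi3 := Real.pi_gt_three
  have hpi4 := Real.pi_lt_four
  have hpi0 := Real.pi_pos
  set a : ℕ := ⌈20 * q ^ 2 / Real.pi⌉₊ with ha
  set b : ℕ := ⌊n / (2 * Real.pi)⌋₊ with hb
  have hgrid : ∀ j, gridAngle n j * (2 * n) = Real.pi * (2 * j + 1) := by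
    intro j
    unfold gridAngle
    field_simp
  have hn2 : (n : ℝ) = q * q ^ 2 := by rw [← hqn]; ring
  -- the first angle is between `20 √h` and `21 √h`
  have ha1 : 20 ≤ gridAngle n a * q := by
    have h1 : 20 * q ^ 2 / Real.pi ≤ a := Nat.le_ceil _
    rw [div_le_iff₀ hpi0] at h1
    have h2 := hgrid a
    rw [hn2] at h2
    have h3 : 0 < q ^ 2 := by positivity
    by_contra! hlt
    nlinarith
  have ha2 : gridAngle n a * q ≤ 21 := by
    have h1 : (a : ℝ) < 20 * q ^ 2 / Real.pi + 1 := Nat.ceil_lt_add_one (by positivity)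
    rw [← sub_lt_iff_lt_add, lt_div_iff₀ hpi0] at h1
    have h2 := hgrid a
    rw [hn2] at h2
    have h3 : 0 < q ^ 2 := by positivity
    by_contra! hlt
    nlinarith
  -- the last angle is between `1 / 4` and `1 / 2`
  have hb1 : ∀ j < b, gridAngle n j ≤ 1 / 2 := by
    intro j hj
    have h1 : (b : ℝ) ≤ n / (2 * Real.pi) := Nat.floor_le (by positivity)
    rw [le_div_iff₀ (by positivity)] at h1
    have h2 := hgrid j
    have h3 : (j : ℝ) + 1 ≤ b := by exact_mod_cast hj
    by_contra! hlt
    nlinarith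
  have hn400 : 400 ≤ (n : ℝ) := by rw [hn2]; nlinarith
  have hb2 : 1 / 4 ≤ gridAngle n b := by
    have h1 : n / (2 * Real.pi) < (b : ℝ) + 1 := Nat.lt_floor_add_one _
    rw [div_lt_iff₀ (by positivity)] at h1
    have h2 := hgrid b
    by_contra! hlt
    nlinarith
  have hab : a ≤ b := by
    by_contra! hlt
    have h1 := gridAngle_mono n hlt.le
    have h2 : gridAngle n b * q ≤ 21 := (mul_le_mul_of_nonneg_right h1 hq0.le).trans ha2
    nlinarith
  have hθa0 := gridAngle_pos hn a
  have hha : 400 * h ≤ gridAngle n a ^ 2 := by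
    have h1 : 400 ≤ (gridAngle n a * q) ^ 2 := by nlinarith
    rw [hh, ← div_eq_mul_inv, div_le_iff₀ (by positivity), ← mul_pow]
    exact h1
  set Xa := Real.log (18 * gridAngle n a ^ 2 / h) with hXa
  set Xb := Real.log (18 * gridAngle n b ^ 2 / h) with hXb
  have hXa0 : 0 ≤ Xa := Real.log_nonneg ((one_le_div hh0).2 (by linarith))
  -- `7938 = 18 * 21 ^ 2`
  have hXa1 : Xa ≤ Real.log 7938 := by
    refine Real.log_le_log (by positivity) ?_
    rw [hh, div_inv_eq_mul, mul_assoc, ← mul_pow]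
    nlinarith
  have hT0 : 0 ≤ Real.log ((n : ℝ) ^ (2 / 3 : ℝ)) := by
    rw [hpow]
    exact Real.log_nonneg (one_le_pow₀ hq1)
  have hXb1 : Real.log ((n : ℝ) ^ (2 / 3 : ℝ)) ≤ Xb := by
    rw [hpow]
    refine Real.log_le_log (by positivity) ?_
    rw [hh, div_inv_eq_mul]
    nlinarith [sq_nonneg q]
  have hsum := integral_le_sum_gridAngle hf hn hh0 hab (by linarith)
  rw [← hXa, ← hXb] at hsum
  set S := ∑ j ∈ Finset.Ico a b, f (Real.log (18 * gridAngle n j ^ 2 / h)) / gridAngle n j with hS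
  have hint : (∫ x in (0 : ℝ)..Real.log ((n : ℝ) ^ (2 / 3 : ℝ)), f x) - f 0 * Real.log 7938 ≤
      2 * Real.pi / n * S := by
    have hXb0 := hT0.trans hXb1
    have h1 : ∫ x in (0 : ℝ)..Xa, f x ≤ f 0 * Real.log 7938 := by
      have := hf.integral_le le_rfl hXa0
      rw [sub_zero] at this
      refine this.trans ?_
      have := (hf.pos 0 le_rfl).le
      gcongr
    have h2 : ∫ x in (0 : ℝ)..Real.log ((n : ℝ) ^ (2 / 3 : ℝ)), f x ≤ ∫ x in (0 : ℝ)..Xb, f x := by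
      refine intervalIntegral.integral_mono_interval le_rfl hT0 hXb1 ?_
        (hf.intervalIntegrable le_rfl hXb0)
      filter_upwards [ae_restrict_mem measurableSet_Ioc] with x hx
      exact (hf.pos x hx.1.le).le
    have h3 := intervalIntegral.integral_add_adjacent_intervals
      (hf.intervalIntegrable le_rfl hXa0) (hf.intervalIntegrable hXa0 hXb0)
    linarith
  have hES := sum_gridAngle_le_eigenvalueSum (p := p) (by linarith) hf hm hn hh0 hbig'
    (v := potential n) (fun k => rfl) hha hb1
  rw [← hS] at hES
  have hD : 0 < n * h ^ p := by positivity
  rw [ratio, normPow_potential (by linarith), ENNReal.le_div_iff_mul_le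
    (Or.inl (ENNReal.ofReal_pos.2 hD).ne') (Or.inl ENNReal.ofReal_ne_top),
    ← ENNReal.ofReal_mul' hD.le]
  refine le_trans (ENNReal.ofReal_le_ofReal ?_) hES
  have hhp : (h / 2) ^ p = (1 / 2) ^ p * h ^ p := by
    rw [← Real.mul_rpow (by norm_num) hh0.le]
    congr 1
    ring
  calc (1 / 2) ^ p / (18 * Real.pi) *
        ((∫ x in (0 : ℝ)..Real.log ((n : ℝ) ^ (2 / 3 : ℝ)), f x) - f 0 * Real.log 7938) *
        (n * h ^ p)
      ≤ (1 / 2) ^ p / (18 * Real.pi) * (2 * Real.pi / n * S) * (n * h ^ p) := by gcongr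
    _ = (h / 2) ^ p / 9 * S := by
        rw [hhp]
        field_simp
        ring

theorem eventually_log_le : ∀ᶠ n : ℕ in atTop,
    400 * (Real.log (4 * ((n : ℝ) ^ (1 / 3 : ℝ)) ^ 2) + 1) ≤ (n : ℝ) ^ (1 / 3 : ℝ) := by
  have hq : Tendsto (fun n : ℕ => (n : ℝ) ^ (1 / 3 : ℝ)) atTop atTop :=
    (tendsto_rpow_atTop (by norm_num)).comp tendsto_natCast_atTop_atTop
  have hreal : ∀ᶠ q : ℝ in atTop, 400 * (Real.log (4 * q ^ 2) + 1) ≤ q := by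
    have h1 := Real.isLittleO_log_id_atTop.bound (c := 1 / 1600) (by norm_num)
    filter_upwards [h1, eventually_ge_atTop (800 * (Real.log 4 + 1)), eventually_ge_atTop 1]
      with q h1 h2 h3
    have hlog : 0 ≤ Real.log q := Real.log_nonneg h3
    simp only [id_eq, Real.norm_eq_abs, abs_of_nonneg hlog,
      abs_of_nonneg (zero_le_one.trans h3)] at h1
    rw [Real.log_mul (by norm_num) (by positivity), Real.log_pow]
    push_cast
    linarith
  exact hq.eventually hreal

/-- The lower bound holds from some `n` on that does not depend on `f` and on the way of
counting. -/
theorem eventually_ofReal_le_ratio_potential {p : ℝ} (hp : 1 ≤ p) : ∀ᶠ n : ℕ in atTop,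
    ∀ f : ℝ → ℝ, IsNonintegrableWeight f → ∀ m ∈ countings,
      ENNReal.ofReal ((1 / 2) ^ p / (18 * Real.pi) *
        ((∫ x in (0 : ℝ)..Real.log ((n : ℝ) ^ (2 / 3 : ℝ)), f x) - f 0 * Real.log 7938)) ≤
      ratio m p f 1 (potential n) 1 := by
  filter_upwards [eventually_log_le, eventually_ge_atTop 1] with n hlog hn f hf m hm
  have hn1 : (1 : ℝ) ≤ n := by exact_mod_cast hn
  refine ofReal_le_ratio_potential hp hf hm (Real.one_le_rpow hn1 (by norm_num)) ?_ hlog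
  rw [← Real.rpow_natCast, ← Real.rpow_mul (by positivity)]
  norm_num

theorem IsNonintegrableWeight.tendsto_integral {f : ℝ → ℝ} (hf : IsNonintegrableWeight f) :
    Tendsto (fun t : ℝ => ∫ x in (0 : ℝ)..t, f x) atTop atTop := by
  have hmeas : AEMeasurable (fun x => ENNReal.ofReal (f x)) (volume.restrict (Ioi 0)) :=
    ((hf.continuousOn.mono Ioi_subset_Ici_self).aemeasurable measurableSet_Ioi).ennreal_ofReal
  have hlim := (aecover_Iic (μ := volume.restrict (Ioi (0 : ℝ)))
    tendsto_id).lintegral_tendsto_of_countably_generated hmeas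
  rw [hf.lintegral_eq_top] at hlim
  rw [← ENNReal.tendsto_ofReal_nhds_top]
  refine hlim.congr' ?_
  filter_upwards [eventually_ge_atTop 0] with t ht
  rw [Measure.restrict_restrict measurableSet_Iic, id, inter_comm, Ioi_inter_Iic,
    intervalIntegral.integral_of_le ht, ofReal_integral_eq_lintegral_ofReal]
  · exact (hf.intervalIntegrable le_rfl ht).1
  · filter_upwards [ae_restrict_mem measurableSet_Ioc] with x hx
    exact (hf.pos x hx.1.le).le

end Jacobi

theorem mainTheorem9 (p : ℝ) (hp : 1 ≤ p) :
    (∃ C : ℝ, 0 < C ∧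
      ∀ γ : ℝ, 2 / 3 < γ → γ < 1 →
      ∀ g : ℝ → ℝ, (∀ x, 1 ≤ x → 1 ≤ g x) →
        Filter.Tendsto (fun n : ℕ => g n) Filter.atTop Filter.atTop →
        Filter.Tendsto (fun n : ℕ => g n / (n : ℝ) ^ (γ - 2 / 3)) Filter.atTop (nhds 0) →
      ∃ N : ℕ, 2 ≤ N ∧
        ∀ f : ℝ → ℝ, Jacobi.IsNonintegrableWeight f →
        ∀ n : ℕ, N ≤ n → ∀ m ∈ Jacobi.countings,
          ENNReal.ofReal (C * ((∫ x in (0 : ℝ)..Real.log ((n : ℝ) ^ (2 / 3 : ℝ)), f x)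
              - 3 * f 0 * Real.log (g n)))
            ≤ Jacobi.ratio m p f 1 (Jacobi.potential n) 1 ∧
          ENNReal.ofReal (C * ((∫ x in (0 : ℝ)..Real.log ((n : ℝ) ^ (2 / 3 : ℝ)), f x)
              - 3 * f 0 * Real.log (g n)))
            ≤ Jacobi.supRatio m p f) ∧
    (∀ f : ℝ → ℝ, Jacobi.IsNonintegrableWeight f →
      ∀ m ∈ Jacobi.countings, Jacobi.supRatio m p f = ⊤) := by
  have hC : 0 < (1 / 2 : ℝ) ^ p / (18 * Real.pi) := by positivity
  refine ⟨⟨_, hC, ?_⟩, ?_⟩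
  · intro γ _ _ g _ hg _
    have hlog := (Real.tendsto_log_atTop.comp hg).eventually_ge_atTop (Real.log 7938)
    -- `g` only has to be so large that `log (g n)` absorbs the constant `log 7938`
    obtain ⟨N, hN⟩ := Filter.eventually_atTop.1
      (hlog.and (Jacobi.eventually_ofReal_le_ratio_potential hp))
    refine ⟨max N 2, le_max_right _ _, fun f hf n hn m hm => ?_⟩
    obtain ⟨h1, h2⟩ := hN n ((le_max_left _ _).trans hn)
    have hratio := h2 f hf m hm
    have hle : ENNReal.ofReal ((1 / 2 : ℝ) ^ p / (18 * Real.pi) *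
        ((∫ x in (0 : ℝ)..Real.log ((n : ℝ) ^ (2 / 3 : ℝ)), f x) - 3 * f 0 * Real.log (g n))) ≤
        Jacobi.ratio m p f 1 (Jacobi.potential n) 1 := by
      refine le_trans (ENNReal.ofReal_le_ofReal ?_) hratio
      have hf0 := hf.pos 0 le_rfl
      have hK : 0 ≤ Real.log 7938 := Real.log_nonneg (by norm_num)
      have h3 : f 0 * Real.log 7938 ≤ 3 * f 0 * Real.log (g n) := by
        have h1' : Real.log 7938 ≤ Real.log (g n) := h1
        nlinarith [mul_le_mul_of_nonneg_left h1' hf0.le, mul_nonneg hf0.le (hK.trans h1')]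
      gcongr
    have hn1 : 1 ≤ n := le_trans (by norm_num) ((le_max_right N 2).trans hn)
    exact ⟨hle, hle.trans (Jacobi.ratio_le_supRatio p m f hn1)⟩
  · intro f hf m hm
    have hlogn : Filter.Tendsto (fun n : ℕ => Real.log ((n : ℝ) ^ (2 / 3 : ℝ)))
        Filter.atTop Filter.atTop :=
      Real.tendsto_log_atTop.comp
        ((tendsto_rpow_atTop (by norm_num)).comp tendsto_natCast_atTop_atTop)
    have hlim : Filter.Tendsto (fun n : ℕ => ENNReal.ofReal ((1 / 2 : ℝ) ^ p / (18 * Real.pi) *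
        ((∫ x in (0 : ℝ)..Real.log ((n : ℝ) ^ (2 / 3 : ℝ)), f x) - f 0 * Real.log 7938)))
        Filter.atTop (nhds ⊤) := by
      refine ENNReal.tendsto_ofReal_atTop.comp ?_
      refine Filter.Tendsto.const_mul_atTop hC ?_
      exact Filter.tendsto_atTop_add_const_right _ _ (hf.tendsto_integral.comp hlogn)
    refine top_le_iff.1 (le_of_tendsto hlim ?_)
    filter_upwards [Jacobi.eventually_ofReal_le_ratio_potential hp,
      Filter.eventually_ge_atTop 1] with n hn hn1
    exact (hn f hf m hm).trans (Jacobi.ratio_le_supRatio p m f hn1)
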